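/- Let $n\ge 1$ and let $M$ be a (nonempty) smooth manifold of dimension $2n+1$ with a Riemannian metric $g$, Levi-Civita connection $\nabla$, curvature $R(x,y)z=\nabla_x\nabla_yz-\nabla_y\nabla_xz-\nabla_{[x,y]}z$, Ricci tensor $\rho(y,z)=\operatorname{tr}(x\mapsto R(x,y)z)$ and Ricci operator $Q$, $g(Qx,y)=\rho(x,y)$. Let $(\phi,\xi,\eta)$ be a Riemannian $\Pi$-structure on $(M,g)$: a smooth $(1,1)$-tensor field $\phi$, a vector field $\xi$ and a 1-form $\eta$ with $$\phi\xi=0,\quad \phi^2=I-\eta\otimes\xi,\quad \eta\circ\phi=0,\quad \eta(\xi)=1,\quad \operatorname{tr}\phi=0,\quad g(\phi x,\phi y)=g(x,y)-\eta(x)\eta(y),$$ and put $\tilde g(x,y)=g(x,\phi y)+\eta(x)\eta(y)$. Assume that the structure is para-Sasaki-like, i.e. $$(\nabla_x\phi)y=-g(x,y)\xi-\eta(y)x+2\eta(x)\eta(y)\xi,$$ and that it admits a para-Ricci-like soliton with vertical potential, i.e. there are a smooth function $k$ on $M$ and constants $\lambda,\mu,\nu\in\mathbb R$ such that, with $v=k\xi$,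 $$\rho=-\tfrac12\mathcal L_vg-\lambda g-\mu\tilde g-\nu\,\eta\otimes\eta .$$ Then: (i) $M$ is locally Ricci $\phi$-symmetric: $Q\not\equiv0$ and $\phi^2(\nabla_xQ)y=0$ for all $x$ and all $y$ orthogonal to $\xi$. (ii) Each of the following properties holds if and only if $(M,g)$ is Einstein, i.e. $\rho=a\,g$ for some constant $a$: a) $M$ is locally Ricci symmetric: $\nabla\rho=0$; b) $M$ is Ricci semi-symmetric: $\rho(R(x,y)z,w)+\rho(z,R(x,y)w)=0$; c) $M$ is globally Ricci $\phi$-symmetric: $Q\not\equiv 0$ and $\phi^2(\nabla_xQ)y=0$ for all $x,y$; d) $M$ is almost pseudo Ricci symmetric: $\rho\not\equiv0$ and there are 1-forms $\alpha,\beta$ with $(\nabla_x\rho)(y,z)=\{\alpha(x)+\beta(x)\}\rho(y,z)+\alpha(y)\rho(x,z)+\alpha(z)\rho(x,y)$; the equivalence holds both when $\alpha$ and $\beta$ are required to be not identically zero and when this is not required; e) $M$ is special weakly Ricci symmetric: $\rho\not\equiv0$ and there is a 1-form $\alpha$ with $(\nabla_x\rho)(y,z)=2\alpha(x)\rho(y,z)+\alpha(y)\rho(x,z)+\alpha(z)\rho(x,y)$;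 f) $M$ has cyclic parallel Ricci tensor: $\rho\not\equiv0$ and $(\nabla_x\rho)(y,z)+(\nabla_y\rho)(z,x)+(\nabla_z\rho)(x,y)=0$; g) $M$ has Ricci tensor of Codazzi type: $\rho\not\equiv0$ and $(\nabla_x\rho)(y,z)=(\nabla_y\rho)(x,z)$. -/

import Mathlib

open Bundle FiberBundle VectorField
open scoped Manifold ContDiff

noncomputable section

namespace PiManifold

variable {E : Type*} [NormedAddCommGroup E] [NormedSpace ℝ E] [FiniteDimensional ℝ E]
  {H : Type*} [TopologicalSpace H] {I : ModelWithCorners ℝ E H}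
  {M : Type*} [TopologicalSpace M] [ChartedSpace H M] [IsManifold I ∞ M]

instance finiteDimensional_tangentSpace (p : M) : FiniteDimensional ℝ (TangentSpace I p) :=
  inferInstanceAs (FiniteDimensional ℝ E)

instance t2Space_tangentSpace (p : M) : T2Space (TangentSpace I p) :=
  inferInstanceAs (T2Space E)

/-! ### The Levi-Civita connection of a Riemannian metric -/

section LeviCivita

variable (g : ContMDiffRiemannianMetric I ∞ E (fun p : M ↦ TangentSpace I p))

/-- The linear isomorphism `v ↦ g(v, ·)` from the tangent space to its dual. -/
def flat (p : M) : TangentSpace I p ≃ₗ[ℝ] Module.Dual ℝ (TangentSpace I p) :=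
  LinearEquiv.ofInjectiveOfFinrankEq
    (ContinuousLinearMap.coeLM ℝ ∘ₗ (g.inner p).toLinearMap)
    (by
      rw [injective_iff_map_eq_zero]
      intro v hv
      by_contra hne
      have h0 : g.inner p v v = 0 := LinearMap.congr_fun hv v
      exact (g.pos p v hne).ne' h0)
    (Subspace.dual_finrank_eq).symm

lemma flat_apply (p : M) (v w : TangentSpace I p) : flat g p v w = g.inner p v w := rfl

set_option linter.unusedSectionVars false in
lemma mdifferentiableAt_inner {X Y : Π p : M, TangentSpace I p} {p : M}
    (hX : MDiffAt (T% X) p) (hY : MDiffAt (T% Y) p) :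
    MDiffAt (fun q ↦ g.inner q (X q) (Y q)) p := by
  have h := MDifferentiableAt.clm_bundle_apply₂ (F₁ := E) (F₂ := E) (F₃ := ℝ) (IB := I) (IM := I)
    (E₁ := fun p : M ↦ TangentSpace I p) (E₂ := fun p : M ↦ TangentSpace I p)
    (E₃ := Trivial M ℝ) (b := id) (x := p) (g.contMDiff.mdifferentiableAt (by simp)) hX hY
  simp only [mdifferentiableAt_totalSpace] at h
  exact h.2

/-- The right-hand side of the Koszul formula for `2 g(∇_X Y, Z)`. -/
def koszul (X Y Z : Π p : M, TangentSpace I p) (p : M) : ℝ :=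
  mvfderiv I (fun q ↦ g.inner q (Y q) (Z q)) p (X p)
    + mvfderiv I (fun q ↦ g.inner q (X q) (Z q)) p (Y p)
    - mvfderiv I (fun q ↦ g.inner q (X q) (Y q)) p (Z p)
    + g.inner p (mlieBracket I X Y p) (Z p)
    - g.inner p (mlieBracket I X Z p) (Y p)
    - g.inner p (mlieBracket I Y Z p) (X p)

lemma tensorialAt_koszul_right {X Y : Π p : M, TangentSpace I p} {p : M}
    (hX : MDiffAt (T% X) p) (hY : MDiffAt (T% Y) p) :
    TensorialAt I E (fun Z ↦ koszul g X Y Z p) p where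
  smul {f Z} hf hZ := by
    have := FiniteDimensional.complete ℝ E
    simp [koszul, mvfderiv_fun_mul hf (mdifferentiableAt_inner g hX hZ),
      mvfderiv_fun_mul hf (mdifferentiableAt_inner g hY hZ), mlieBracket_smul_right hf hZ]
    rw [g.symm p (Z p) (X p), g.symm p (Z p) (Y p)]
    ring
  add {Z Z'} hZ hZ' := by
    have := FiniteDimensional.complete ℝ E
    simp [koszul, mvfderiv_fun_add (mdifferentiableAt_inner g hX hZ)
      (mdifferentiableAt_inner g hX hZ'), mvfderiv_fun_add (mdifferentiableAt_inner g hY hZ)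
      (mdifferentiableAt_inner g hY hZ'), mlieBracket_add_right hZ hZ']
    ring

lemma tensorialAt_koszul_left {Y Z : Π p : M, TangentSpace I p} {p : M}
    (hY : MDiffAt (T% Y) p) (hZ : MDiffAt (T% Z) p) :
    TensorialAt I E (fun X ↦ koszul g X Y Z p) p where
  smul {f X} hf hX := by
    have := FiniteDimensional.complete ℝ E
    simp [koszul, mvfderiv_fun_mul hf (mdifferentiableAt_inner g hX hZ),
      mvfderiv_fun_mul hf (mdifferentiableAt_inner g hX hY), mlieBracket_smul_left hf hX]
    ring
  add {X X'} hX hX' := by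
    have := FiniteDimensional.complete ℝ E
    simp [koszul, mvfderiv_fun_add (mdifferentiableAt_inner g hX hZ)
      (mdifferentiableAt_inner g hX' hZ), mvfderiv_fun_add (mdifferentiableAt_inner g hX hY)
      (mdifferentiableAt_inner g hX' hY), mlieBracket_add_left hX hX']
    ring

/-- For a vector field `Y` differentiable at `p`, the Koszul expression at `p` as a bilinear form
in the values of `X` and `Z` at `p`. -/
def koszulForm {Y : Π p : M, TangentSpace I p} {p : M} (hY : MDiffAt (T% Y) p) :
    TangentSpace I p →L[ℝ] TangentSpace I p →L[ℝ] ℝ :=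
  TensorialAt.mkHom₂ (fun X Z ↦ koszul g X Y Z p) p
    (fun _ hZ ↦ tensorialAt_koszul_left g hY hZ) (fun _ hX ↦ tensorialAt_koszul_right g hX hY)

lemma koszulForm_apply {X Y Z : Π p : M, TangentSpace I p} {p : M} (hX : MDiffAt (T% X) p)
    (hY : MDiffAt (T% Y) p) (hZ : MDiffAt (T% Z) p) :
    koszulForm g hY (X p) (Z p) = koszul g X Y Z p :=
  TensorialAt.mkHom₂_apply _ _ hX hZ

open Classical in
/-- `leviCivitaFun g Y p u` is the covariant derivative `∇_u Y` at `p`, determined by the Koszul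
formula (and `0` if `Y` is not differentiable at `p`). -/
def leviCivitaFun (Y : Π p : M, TangentSpace I p) (p : M) :
    TangentSpace I p →L[ℝ] TangentSpace I p :=
  if hY : MDiffAt (T% Y) p then
    LinearMap.toContinuousLinearMap ((2⁻¹ : ℝ) • ((flat g p).symm.toLinearMap ∘ₗ
      ContinuousLinearMap.coeLM ℝ ∘ₗ (koszulForm g hY).toLinearMap))
  else 0

lemma two_mul_inner_leviCivitaFun {X Y Z : Π p : M, TangentSpace I p} {p : M}
    (hX : MDiffAt (T% X) p) (hY : MDiffAt (T% Y) p) (hZ : MDiffAt (T% Z) p) :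
    2 * g.inner p (leviCivitaFun g Y p (X p)) (Z p) = koszul g X Y Z p := by
  rw [← koszulForm_apply g hX hY hZ]
  simp only [leviCivitaFun, hY, dite_true]
  have h := flat_apply g p ((flat g p).symm (ContinuousLinearMap.coeLM ℝ (koszulForm g hY (X p))))
    (Z p)
  rw [LinearEquiv.apply_symm_apply] at h
  simp
  exact h.symm

lemma eq_of_two_mul_inner_eq {p : M} {u v : TangentSpace I p}
    (h : ∀ w, 2 * g.inner p u w = 2 * g.inner p v w) : u = v := by
  apply (flat g p).injective
  ext w
  have := h w
  rw [flat_apply, flat_apply]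
  linarith

/-- The Levi-Civita connection of `g`. In Mathlib's argument order, `leviCivita g Y p u` is
`∇_u Y` at `p`. -/
def leviCivita : CovariantDerivative I E (fun p : M ↦ TangentSpace I p) where
  toFun := leviCivitaFun g
  isCovariantDerivativeOnUniv :=
    { add := by
        intro Y Y' p hY hY' _
        have := FiniteDimensional.complete ℝ E
        ext u
        apply eq_of_two_mul_inner_eq g
        intro w
        have hU := mdifferentiableAt_extend (I := I) (F := E) u
        have hW := mdifferentiableAt_extend (I := I) (F := E) w
        have e0 := two_mul_inner_leviCivitaFun g hU (mdifferentiableAt_add_section hY hY') hW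
        have e1 := two_mul_inner_leviCivitaFun g hU hY hW
        have e2 := two_mul_inner_leviCivitaFun g hU hY' hW
        simp only [extend_apply_self] at e0 e1 e2
        rw [e0]
        simp [mul_add, e1, e2, koszul, mvfderiv_fun_add (mdifferentiableAt_inner g hY hW)
          (mdifferentiableAt_inner g hY' hW), mvfderiv_fun_add (mdifferentiableAt_inner g hU hY)
          (mdifferentiableAt_inner g hU hY'), mlieBracket_add_left hY hY',
          mlieBracket_add_right hY hY']
        ring
      leibniz := by
        intro Y f p hY hf _
        have := FiniteDimensional.complete ℝ E
        ext u
        apply eq_of_two_mul_inner_eq g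
        intro w
        have hU := mdifferentiableAt_extend (I := I) (F := E) u
        have hW := mdifferentiableAt_extend (I := I) (F := E) w
        have e0 := two_mul_inner_leviCivitaFun g hU (hf.smul_section hY) hW
        have e1 := two_mul_inner_leviCivitaFun g hU hY hW
        simp only [extend_apply_self] at e0 e1
        have e2 : 2 * g.inner p ((f p • leviCivitaFun g Y p + (mvfderiv I f p).smulRight (Y p)) u) w
            = f p * koszul g (extend E u) Y (extend E w) p
              + 2 * (mvfderiv I f p u * g.inner p (Y p) w) := by
          simp [← e1]
          ring
        rw [e0, e2]
        simp [koszul, mvfderiv_fun_mul hf (mdifferentiableAt_inner g hY hW),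
          mvfderiv_fun_mul hf (mdifferentiableAt_inner g hU hY), mlieBracket_smul_left hf hY,
          mlieBracket_smul_right hf hY]
        rw [g.symm p u (Y p)]
        ring }

lemma leviCivita_torsion_eq_zero {X Y : Π p : M, TangentSpace I p} {p : M}
    (hX : MDiffAt (T% X) p) (hY : MDiffAt (T% Y) p) :
    leviCivita g Y p (X p) - leviCivita g X p (Y p) = mlieBracket I X Y p := by
  apply eq_of_two_mul_inner_eq g
  intro w
  have hW := mdifferentiableAt_extend (I := I) (F := E) w
  have e1 := two_mul_inner_leviCivitaFun g hX hY hW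
  have e2 := two_mul_inner_leviCivitaFun g hY hX hW
  simp only [extend_apply_self] at e1 e2
  have e3 : (fun q ↦ g.inner q (Y q) (X q)) = fun q ↦ g.inner q (X q) (Y q) :=
    funext fun q ↦ g.symm q _ _
  have e4 : mlieBracket I Y X p = - mlieBracket I X Y p := mlieBracket_swap_apply
  simp only [koszul, e3, e4, extend_apply_self, map_neg, neg_apply] at e1 e2
  simp only [leviCivita, map_sub, sub_apply]
  linarith

lemma leviCivita_metric {X Y Z : Π p : M, TangentSpace I p} {p : M}
    (hX : MDiffAt (T% X) p) (hY : MDiffAt (T% Y) p) (hZ : MDiffAt (T% Z) p) :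
    mvfderiv I (fun q ↦ g.inner q (Y q) (Z q)) p (X p)
      = g.inner p (leviCivita g Y p (X p)) (Z p) + g.inner p (Y p) (leviCivita g Z p (X p)) := by
  have e1 := two_mul_inner_leviCivitaFun g hX hY hZ
  have e2 := two_mul_inner_leviCivitaFun g hX hZ hY
  have e3 : (fun q ↦ g.inner q (Z q) (Y q)) = fun q ↦ g.inner q (Y q) (Z q) :=
    funext fun q ↦ g.symm q _ _
  have e4 : mlieBracket I Z Y p = - mlieBracket I Y Z p := mlieBracket_swap_apply
  simp only [koszul, e3, e4, map_neg, neg_apply] at e1 e2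
  rw [g.symm p (Y p)]
  simp only [leviCivita]
  linarith

end LeviCivita

/-! ### Curvature, covariant derivatives of tensors, Lie derivative of the metric

The tensors below are evaluated at vectors of one tangent space by extending these vectors to
vector fields that are smooth near the base point. -/

section Tensors

variable (g : ContMDiffRiemannianMetric I ∞ E (fun p : M ↦ TangentSpace I p))

/-- `R(X, Y)Z = ∇_X ∇_Y Z - ∇_Y ∇_X Z - ∇_[X, Y] Z` for vector fields. -/
def curvatureField (X Y Z : Π p : M, TangentSpace I p) (p : M) : TangentSpace I p :=
  leviCivita g (fun q ↦ leviCivita g Z q (Y q)) p (X p)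
    - leviCivita g (fun q ↦ leviCivita g Z q (X q)) p (Y p)
    - leviCivita g Z p (mlieBracket I X Y p)

/-- The curvature tensor `R(u, v)w` at `p`. -/
def curvature (p : M) (u v w : TangentSpace I p) : TangentSpace I p :=
  curvatureField g (extend E u) (extend E v) (extend E w) p

/-- The Ricci tensor `ρ(v, w)`, the trace of `u ↦ R(u, v)w`. -/
def ricci (p : M) (v w : TangentSpace I p) : ℝ :=
  ∑ i, (Module.finBasis ℝ (TangentSpace I p)).coord i
    (curvature g p (Module.finBasis ℝ (TangentSpace I p) i) v w)

/-- The Ricci operator `Q`: the vector `Q v` with `g(Q v, w) = ρ(v, w)` for all `w` in a basis of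
the tangent space. -/
def ricciOperator (p : M) (v : TangentSpace I p) : TangentSpace I p :=
  (flat g p).symm ((Module.finBasis ℝ (TangentSpace I p)).constr ℝ
    fun i ↦ ricci g p v (Module.finBasis ℝ (TangentSpace I p) i))

/-- `(∇_u T)v = ∇_u (T v) - T (∇_u v)` for a `(1,1)`-tensor field `T`. -/
def nablaEnd (T : Π p : M, TangentSpace I p → TangentSpace I p) (p : M)
    (u v : TangentSpace I p) : TangentSpace I p :=
  leviCivita g (fun q ↦ T q (extend E v q)) p u - T p (leviCivita g (extend E v) p u)

/-- `(∇_u S)(v, w) = u (S(v, w)) - S(∇_u v, w) - S(v, ∇_u w)` for a `(0,2)`-tensor field `S`. -/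
def nablaForm (S : Π p : M, TangentSpace I p → TangentSpace I p → ℝ) (p : M)
    (u v w : TangentSpace I p) : ℝ :=
  mvfderiv I (fun q ↦ S q (extend E v q) (extend E w q)) p u
    - S p (leviCivita g (extend E v) p u) w - S p v (leviCivita g (extend E w) p u)

/-- `(L_V g)(x, y) = V (g(x, y)) - g([V, x], y) - g(x, [V, y])`. -/
def lieDerivMetric (V : Π p : M, TangentSpace I p) (p : M) (x y : TangentSpace I p) : ℝ :=
  mvfderiv I (fun q ↦ g.inner q (extend E x q) (extend E y q)) p (V p)
    - g.inner p (mlieBracket I V (extend E x) p) y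
    - g.inner p x (mlieBracket I V (extend E y) p)

end Tensors

/-! ### Riemannian Π-manifolds -/

/-- A `1`-form is smooth, as a section of the cotangent bundle. -/
def IsSmoothOneForm (I : ModelWithCorners ℝ E H) {M : Type*} [TopologicalSpace M]
    [ChartedSpace H M] [IsManifold I ∞ M] (α : Π p : M, TangentSpace I p →L[ℝ] ℝ) : Prop :=
  ContMDiff I (I.prod 𝓘(ℝ, E →L[ℝ] ℝ)) ∞
    (fun p ↦ TotalSpace.mk' (E →L[ℝ] ℝ) (E := fun p : M ↦ TangentSpace I p →L[ℝ] ℝ) p (α p))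

/-- An almost paracontact almost paracomplex Riemannian structure `(φ, ξ, η)` on `(M, g)`. -/
structure PiStructure (g : ContMDiffRiemannianMetric I ∞ E (fun p : M ↦ TangentSpace I p)) where
  φ : Π p : M, TangentSpace I p →L[ℝ] TangentSpace I p
  ξ : Π p : M, TangentSpace I p
  η : Π p : M, TangentSpace I p →L[ℝ] ℝ
  smooth_φ : ContMDiff I (I.prod 𝓘(ℝ, E →L[ℝ] E)) ∞
    (fun p ↦ TotalSpace.mk' (E →L[ℝ] E)
      (E := fun p : M ↦ TangentSpace I p →L[ℝ] TangentSpace I p) p (φ p))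
  smooth_ξ : ContMDiff I (I.prod 𝓘(ℝ, E)) ∞
    (fun p ↦ TotalSpace.mk' E (E := fun p : M ↦ TangentSpace I p) p (ξ p))
  smooth_η : IsSmoothOneForm I η
  φ_ξ : ∀ p, φ p (ξ p) = 0
  φ_φ : ∀ p x, φ p (φ p x) = x - η p x • ξ p
  η_φ : ∀ p x, η p (φ p x) = 0
  η_ξ : ∀ p, η p (ξ p) = 1
  trace_φ : ∀ p, LinearMap.trace ℝ (TangentSpace I p) (φ p).toLinearMap = 0
  inner_φ_φ : ∀ p x y, g.inner p (φ p x) (φ p y) = g.inner p x y - η p x * η p y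

namespace PiStructure

variable {g : ContMDiffRiemannianMetric I ∞ E (fun p : M ↦ TangentSpace I p)}
  (S : PiStructure g)

/-- The associated metric `g̃(x, y) = g(x, φ y) + η(x) η(y)`. -/
def assocMetric (p : M) (x y : TangentSpace I p) : ℝ :=
  g.inner p x (S.φ p y) + S.η p x * S.η p y

/-- `(∇_x φ)y = -g(x, y) ξ - η(y) x + 2 η(x) η(y) ξ`. -/
def IsParaSasakiLike : Prop :=
  ∀ (p : M) (x y : TangentSpace I p),
    nablaEnd g (fun q v ↦ S.φ q v) p x y
      = -(g.inner p x y • S.ξ p) - S.η p y • x + (2 * S.η p x * S.η p y) • S.ξ p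

/-- `ρ = -½ L_V g - lam g - mu g̃ - nu η ⊗ η` with constants `lam`, `mu`, `nu`. -/
def IsParaRicciLikeSoliton (V : Π p : M, TangentSpace I p) (lam mu nu : ℝ) : Prop :=
  ∀ (p : M) (x y : TangentSpace I p),
    ricci g p x y = -(1 / 2) * lieDerivMetric g V p x y - lam * g.inner p x y
      - mu * S.assocMetric p x y - nu * (S.η p x * S.η p y)

/-- `Q` is not identically zero and `φ² (∇_x Q) y = 0` for all `x` and all `y` orthogonal
to `ξ`. -/
def IsLocallyRicciPhiSymmetric : Prop :=
  (∃ (p : M) (x : TangentSpace I p), ricciOperator g p x ≠ 0) ∧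
  ∀ (p : M) (x y : TangentSpace I p), g.inner p y (S.ξ p) = 0 →
    S.φ p (S.φ p (nablaEnd g (ricciOperator g) p x y)) = 0

/-- `Q` is not identically zero and `φ² (∇_x Q) y = 0` for all `x` and `y`. -/
def IsGloballyRicciPhiSymmetric : Prop :=
  (∃ (p : M) (x : TangentSpace I p), ricciOperator g p x ≠ 0) ∧
  ∀ (p : M) (x y : TangentSpace I p),
    S.φ p (S.φ p (nablaEnd g (ricciOperator g) p x y)) = 0

end PiStructure

/-! ### Curvature properties of a Riemannian manifold -/

section Properties

variable (g : ContMDiffRiemannianMetric I ∞ E (fun p : M ↦ TangentSpace I p))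

/-- `ρ = a g` with a constant `a`. -/
def IsEinstein : Prop :=
  ∃ a : ℝ, ∀ (p : M) (x y : TangentSpace I p), ricci g p x y = a * g.inner p x y

/-- The Ricci tensor is not identically zero. -/
def RicciNonvanishing : Prop :=
  ∃ (p : M) (x y : TangentSpace I p), ricci g p x y ≠ 0

def IsLocallyRicciSymmetric : Prop :=
  ∀ (p : M) (x y z : TangentSpace I p), nablaForm g (ricci g) p x y z = 0

def IsRicciSemiSymmetric : Prop :=
  ∀ (p : M) (x y z w : TangentSpace I p),
    ricci g p (curvature g p x y z) w + ricci g p z (curvature g p x y w) = 0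

/-- The equation `(∇_x ρ)(y, z) = (α(x) + β(x)) ρ(y, z) + α(y) ρ(x, z) + α(z) ρ(x, y)`. -/
def AlmostPseudoRicciEquation (α β : Π p : M, TangentSpace I p →L[ℝ] ℝ) : Prop :=
  ∀ (p : M) (x y z : TangentSpace I p),
    nablaForm g (ricci g) p x y z = (α p x + β p x) * ricci g p y z
      + α p y * ricci g p x z + α p z * ricci g p x y

/-- Almost pseudo Ricci symmetric, with `1`-forms that may vanish. -/
def IsAlmostPseudoRicciSymmetric : Prop :=
  RicciNonvanishing g ∧ ∃ α β : Π p : M, TangentSpace I p →L[ℝ] ℝ,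
    IsSmoothOneForm I α ∧ IsSmoothOneForm I β ∧ AlmostPseudoRicciEquation g α β

/-- Almost pseudo Ricci symmetric, with `1`-forms that are not identically zero. -/
def IsProperAlmostPseudoRicciSymmetric : Prop :=
  RicciNonvanishing g ∧ ∃ α β : Π p : M, TangentSpace I p →L[ℝ] ℝ,
    IsSmoothOneForm I α ∧ IsSmoothOneForm I β ∧ (∃ p x, α p x ≠ 0) ∧ (∃ p x, β p x ≠ 0) ∧
      AlmostPseudoRicciEquation g α β

/-- `(∇_x ρ)(y, z) = 2 α(x) ρ(y, z) + α(y) ρ(x, z) + α(z) ρ(x, y)` for some `1`-form `α`. -/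
def IsSpecialWeaklyRicciSymmetric : Prop :=
  RicciNonvanishing g ∧ ∃ α : Π p : M, TangentSpace I p →L[ℝ] ℝ, IsSmoothOneForm I α ∧
    ∀ (p : M) (x y z : TangentSpace I p),
      nablaForm g (ricci g) p x y z = 2 * α p x * ricci g p y z
        + α p y * ricci g p x z + α p z * ricci g p x y

def HasCyclicParallelRicci : Prop :=
  RicciNonvanishing g ∧ ∀ (p : M) (x y z : TangentSpace I p),
    nablaForm g (ricci g) p x y z + nablaForm g (ricci g) p y z x
      + nablaForm g (ricci g) p z x y = 0

def HasCodazziRicci : Prop :=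
  RicciNonvanishing g ∧ ∀ (p : M) (x y z : TangentSpace I p),
    nablaForm g (ricci g) p x y z = nablaForm g (ricci g) p y x z

end Properties

end PiManifold

end

/-! The hypotheses force `ρ = -2n η ⊗ η`, and everything follows from this. The para-Sasaki-like
identity gives `∇_X ξ = φX` and `R(X, Y)ξ = η(X)Y - η(Y)X`, hence `ρ(x, ξ) = -2n η(x)`. Since `L_ξ g
= 2g(φ·, ·)`, the soliton equation writes `ρ` through `g`, `g(φ·, ·)`, `η ⊗ η` and `dk`; comparison
with `ρ(·, ξ)` gives `dk = (2n - λ - μ - ν) η` and `ρ = -λ g - (k + μ) g(φ·, ·) + (λ - 2n) η ⊗ η`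
(`ricci_and_mvfderiv_of_soliton`).

The decisive extra relation is `L_ξ ρ = 0` (`dir_xi_ricci`), valid on every para-Sasaki-like
manifold. The flow of `ξ` changes the connection by `-2(g - η ⊗ η) ξ`; this determines `L_ξ R`,
whose trace vanishes because `tr φ = 0`. Applying `L_ξ` to the formula for `ρ`, with `L_ξ φ = 0` and
`L_ξ η = 0`, gives a vanishing combination of `φ` and `φ²`. These are linearly independent by their
traces, so `k = -μ` and `2λ + dk(ξ) = 0`; as `k` is constant, `λ = 0` (`soliton_constants`).

For any `ρ = a g + b η ⊗ η` with constant coefficients, `∇ρ` and `∇Q` are `b` times explicit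
expressions in `φ`, `ξ`, `η`. Part (i) is then immediate. Each property in (ii), except the version
of d) with nonzero forms, is shown equivalent to `b = 0`, which is the Einstein condition; some of
these equivalences need `a + b = ρ(ξ, ξ) ≠ 0`. Here `b = λ - 2n = -2n`, so in fact neither side of
any equivalence in (ii) ever holds; the version of d) with nonzero forms needs this. -/

noncomputable section

namespace PiManifold

/-! ### Smooth functions and smooth vector fields -/

section Fields

set_option linter.unusedSectionVars false

open scoped Topology

variable {E : Type*} [NormedAddCommGroup E] [NormedSpace ℝ E] [FiniteDimensional ℝ E]
  {H : Type*} [TopologicalSpace H] {I : ModelWithCorners ℝ E H}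
  {M : Type*} [TopologicalSpace M] [ChartedSpace H M] [IsManifold I ∞ M]

/-- Smooth real functions on `M`. -/
abbrev SmoothFun (I : ModelWithCorners ℝ E H) (M : Type*) [TopologicalSpace M] [ChartedSpace H M] :=
  ContMDiffMap I 𝓘(ℝ, ℝ) M ℝ ∞

/-- Smooth vector fields on `M`. -/
abbrev SmoothField (I : ModelWithCorners ℝ E H) (M : Type*) [TopologicalSpace M]
    [ChartedSpace H M] [IsManifold I ∞ M] :=
  ContMDiffSection I E ∞ (fun p : M ↦ TangentSpace I p)

lemma SmoothFun.mdiffAt (f : SmoothFun I M) (p : M) : MDiffAt (fun q ↦ f q) p :=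
  f.contMDiff.mdifferentiableAt (by simp)

lemma SmoothField.mdiffAt (X : SmoothField I M) (p : M) : MDiffAt (T% (fun q ↦ X q)) p :=
  X.contMDiff.mdifferentiableAt (by simp)

/-- The product `f X` of a smooth function and a smooth vector field. -/
def fieldSMul (f : SmoothFun I M) (X : SmoothField I M) : SmoothField I M :=
  ⟨fun p ↦ f p • X p, f.contMDiff.smul_section X.contMDiff⟩

/-- The derivative `X f` of a smooth function along a smooth vector field. -/
def dir (X : SmoothField I M) (f : SmoothFun I M) : SmoothFun I M :=
  ⟨fun p ↦ mvfderiv I f p (X p), by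
    have h := (f.contMDiff.contMDiff_tangentMap (m := ∞) (by simp)).comp X.contMDiff
    have h2 := (contMDiff_snd_tangentBundle_modelSpace ℝ 𝓘(ℝ, ℝ) (n := ∞)).comp h
    exact h2⟩

lemma dir_apply (X : SmoothField I M) (f : SmoothFun I M) (p : M) :
    dir X f p = mvfderiv I f p (X p) := rfl

/-- The Lie bracket of smooth vector fields. -/
def bracket (X Y : SmoothField I M) : SmoothField I M :=
  ⟨mlieBracket I X Y, by
    have := FiniteDimensional.complete ℝ E
    have : IsManifold I (minSmoothness ℝ 2) M := by
      simp only [minSmoothness_of_isRCLikeNormedField]; exact .of_le (n := ∞) (ENat.LEInfty.out)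
    have : IsManifold I (((⊤ : ℕ∞) : WithTop ℕ∞) + 1) M := by simpa using ‹IsManifold I ∞ M›
    exact ContDiff.mlieBracket_vectorField (n := ⊤) (m := ⊤) X.contMDiff Y.contMDiff (by simp)⟩

lemma bracket_jacobi (X Y Z : SmoothField I M) :
    bracket X (bracket Y Z) = bracket (bracket X Y) Z + bracket Y (bracket X Z) := by
  have := FiniteDimensional.complete ℝ E
  have : IsManifold I (minSmoothness ℝ 3) M := by
    simp only [minSmoothness_of_isRCLikeNormedField]; exact .of_le (n := ∞) (ENat.LEInfty.out)
  ext p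
  refine leibniz_identity_mlieBracket_apply ?_ ?_ ?_
  · exact X.contMDiff.contMDiffAt.of_le (by simpa using ENat.LEInfty.out)
  · exact Y.contMDiff.contMDiffAt.of_le (by simpa using ENat.LEInfty.out)
  · exact Z.contMDiff.contMDiffAt.of_le (by simpa using ENat.LEInfty.out)

lemma bracket_swap (X Y : SmoothField I M) : bracket X Y = -bracket Y X := by
  ext p
  exact mlieBracket_swap_apply

lemma bracket_add_right (X Y Z : SmoothField I M) :
    bracket X (Y + Z) = bracket X Y + bracket X Z := by
  have := FiniteDimensional.complete ℝ E
  ext p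
  exact mlieBracket_add_right (Y.mdiffAt p) (Z.mdiffAt p)

lemma bracket_fieldSMul_right (X Y : SmoothField I M) (f : SmoothFun I M) :
    bracket X (fieldSMul f Y) = fieldSMul (dir X f) Y + fieldSMul f (bracket X Y) := by
  have := FiniteDimensional.complete ℝ E
  ext p
  exact mlieBracket_smul_right (f.mdiffAt p) (Y.mdiffAt p)

lemma dir_add (X : SmoothField I M) (f h : SmoothFun I M) : dir X (f + h) = dir X f + dir X h := by
  ext p
  have := mvfderiv_fun_add (f.mdiffAt p) (h.mdiffAt p)
  change mvfderiv I (fun q ↦ f q + h q) p (X p) = _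
  rw [this]
  rfl

lemma dir_mul (X : SmoothField I M) (f h : SmoothFun I M) :
    dir X (f * h) = f * dir X h + h * dir X f := by
  ext p
  have := mvfderiv_fun_mul (f.mdiffAt p) (h.mdiffAt p)
  change mvfderiv I (fun q ↦ f q * h q) p (X p) = _
  rw [this]
  rfl

/-! ### Cut-off: local sections and functions as germs of global smooth ones -/

variable [T2Space M]

/-- A local section that is smooth on an open set agrees near each point of it with a globally
smooth vector field. -/
lemma exists_smoothField_eventuallyEq_section {p : M} {u : Set M} (hu : IsOpen u) (hp : p ∈ u)
    {s : Π q : M, TangentSpace I q} (hs : ContMDiffOn I (I.prod 𝓘(ℝ, E)) ∞ (T% s) u) :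
    ∃ X : SmoothField I M, ∀ᶠ q in 𝓝 p, X q = s q := by
  obtain ⟨χ, hχ, -⟩ := (SmoothBumpFunction.nhds_basis_support (I := I) (hu.mem_nhds hp)).mem_iff.1
    (hu.mem_nhds hp)
  refine ⟨⟨fun q ↦ χ q • s q, ContMDiffOn.smul_section_of_tsupport
    (χ.contMDiff.contMDiffOn) hu hχ hs⟩, ?_⟩
  filter_upwards [χ.eventuallyEq_one] with q hq
  change χ q • s q = s q
  simp [hq]

lemma exists_smoothField_extend {p : M} (v : TangentSpace I p) :
    ∃ X : SmoothField I M, ∀ᶠ q in 𝓝 p, X q = extend E v q := by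
  obtain ⟨s, hs, h⟩ := exists_contMDiffOn_extend (k := ∞) I E v
  obtain ⟨u, hus, hu, hp⟩ := mem_nhds_iff.1 hs
  exact exists_smoothField_eventuallyEq_section hu hp (h.mono hus)

lemma exists_smoothField_apply_eq {p : M} (v : TangentSpace I p) :
    ∃ X : SmoothField I M, X p = v := by
  obtain ⟨X, hX⟩ := exists_smoothField_extend v
  exact ⟨X, by simpa using hX.self_of_nhds⟩

lemma exists_smoothFun_eventuallyEq {p : M} {u : Set M} (hu : IsOpen u) (hp : p ∈ u)
    {f : M → ℝ} (hf : ContMDiffOn I 𝓘(ℝ, ℝ) ∞ f u) :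
    ∃ h : SmoothFun I M, ∀ᶠ q in 𝓝 p, h q = f q := by
  obtain ⟨χ, hχ, -⟩ := (SmoothBumpFunction.nhds_basis_support (I := I) (hu.mem_nhds hp)).mem_iff.1
    (hu.mem_nhds hp)
  refine ⟨⟨fun q ↦ χ q • f q, contMDiff_of_tsupport fun x hx ↦ ?_⟩, ?_⟩
  · have hxu : x ∈ u := hχ (tsupport_smul_subset_left _ _ hx)
    exact χ.contMDiff.contMDiffAt.smul (hf.contMDiffAt (hu.mem_nhds hxu))
  · filter_upwards [χ.eventuallyEq_one] with q hq
    change χ q • f q = f q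
    simp [hq]

/-- `[X, Y] f = X (Y f) - Y (X f)`. -/
lemma dir_bracket (X Y : SmoothField I M) (f : SmoothFun I M) :
    dir (bracket X Y) f = dir X (dir Y f) - dir Y (dir X f) := by
  ext p
  by_cases hz : ∀ v : TangentSpace I p, v = 0
  -- The main argument needs a nonzero tangent vector; in a zero tangent space all derivatives
  -- vanish.
  · simp [dir_apply, hz (X p), hz (Y p), hz (bracket X Y p)]
  push Not at hz
  obtain ⟨z, hz⟩ := hz
  obtain ⟨Z, hZ⟩ := exists_smoothField_apply_eq z
  -- Expanding the Jacobi identity for `X, Y, fZ` by the Leibniz rule and subtracting `f` times the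
  -- identity for `X, Y, Z` leaves the claimed equality multiplied by `Z`.
  have h := bracket_jacobi X Y (fieldSMul f Z)
  simp only [bracket_fieldSMul_right, bracket_add_right] at h
  have hJ := bracket_jacobi X Y Z
  have h1 := congrArg (fun W : SmoothField I M ↦ W p) h
  rw [hJ] at h1
  simp [fieldSMul, hZ] at h1
  have h2 : (dir X (dir Y f) p - dir Y (dir X f) p - dir (bracket X Y) f p) • z = 0 := by
    rw [← sub_eq_zero] at h1
    rw [← h1]
    module
  have h3 := (smul_eq_zero.1 h2).resolve_right hz
  change _ = dir X (dir Y f) p - dir Y (dir X f) p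
  linarith

end Fields

/-! ### The Levi-Civita connection on smooth vector fields -/

section Connection

set_option linter.unusedSectionVars false

open scoped Topology

variable {E : Type*} [NormedAddCommGroup E] [NormedSpace ℝ E] [FiniteDimensional ℝ E]
  {H : Type*} [TopologicalSpace H] {I : ModelWithCorners ℝ E H}
  {M : Type*} [TopologicalSpace M] [ChartedSpace H M] [IsManifold I ∞ M]
  (g : ContMDiffRiemannianMetric I ∞ E (fun p : M ↦ TangentSpace I p))

/-- The smooth function `g(X, Y)`. -/
def ip (X Y : SmoothField I M) : SmoothFun I M :=
  ⟨fun p ↦ g.inner p (X p) (Y p), by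
    have h := ContMDiff.clm_bundle_apply₂ (F₁ := E) (F₂ := E) (F₃ := ℝ) (IB := I) (IM := I)
      (E₁ := fun p : M ↦ TangentSpace I p) (E₂ := fun p : M ↦ TangentSpace I p)
      (E₃ := Trivial M ℝ) (b := id) g.contMDiff X.contMDiff Y.contMDiff
    intro p
    exact ((contMDiffAt_totalSpace).1 (h p)).2⟩

lemma ip_apply (X Y : SmoothField I M) (p : M) : ip g X Y p = g.inner p (X p) (Y p) := rfl

lemma ip_comm (X Y : SmoothField I M) : ip g X Y = ip g Y X := by
  ext p
  exact g.symm p _ _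

lemma ip_add_left (X Y Z : SmoothField I M) : ip g (X + Y) Z = ip g X Z + ip g Y Z := by
  ext p
  simp [ip_apply]

lemma ip_sub_left (X Y Z : SmoothField I M) : ip g (X - Y) Z = ip g X Z - ip g Y Z := by
  ext p
  simp [ip_apply]

lemma ip_neg_left (X Z : SmoothField I M) : ip g (-X) Z = - ip g X Z := by
  ext p
  simp [ip_apply]

lemma ip_sub_right (X Y Z : SmoothField I M) : ip g Z (X - Y) = ip g Z X - ip g Z Y := by
  ext p
  simp [ip_apply]

lemma ip_fieldSMul_left (f : SmoothFun I M) (X Z : SmoothField I M) :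
    ip g (fieldSMul f X) Z = f * ip g X Z := by
  ext p
  simp [ip_apply, fieldSMul]

lemma eq_of_inner_eq {p : M} {u v : TangentSpace I p}
    (h : ∀ w, g.inner p u w = g.inner p v w) : u = v :=
  eq_of_two_mul_inner_eq g fun w ↦ by rw [h w]

variable {ι : Type*} [Fintype ι]

/-- In terms of a pair of dual families, `v = ∑ g(v, e i) f i`. -/
lemma eq_sum_of_dual [DecidableEq ι] {p : M} (hι : Fintype.card ι = Module.finrank ℝ (TangentSpace I p))
    {e f : ι → TangentSpace I p} (h : ∀ i j, g.inner p (e i) (f j) = if i = j then 1 else 0)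
    (v : TangentSpace I p) : v = ∑ i, g.inner p v (e i) • f i := by
  have hli : LinearIndependent ℝ f := by
    rw [Fintype.linearIndependent_iff]
    intro c hc j
    have := congrArg (g.inner p (e j)) hc
    simpa [h] using this
  let b := basisOfLinearIndependentOfCardEqFinrank' f hli hι
  have hb : ∀ i, b i = f i := fun i ↦ by simp [b]
  have hs := b.sum_repr v
  simp only [hb] at hs
  have hc : ∀ i, g.inner p v (e i) = b.repr v i := by
    intro i
    conv_lhs => rw [← hs]
    rw [g.symm]
    simp [h]
  simp_rw [hc, hs]

variable [T2Space M]

lemma eq_of_ip_eq {X Y : SmoothField I M} (h : ∀ Z, ip g X Z = ip g Y Z) : X = Y := by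
  ext p
  refine eq_of_inner_eq g fun w ↦ ?_
  obtain ⟨W, rfl⟩ := exists_smoothField_apply_eq w
  exact congrArg (fun f : SmoothFun I M ↦ f p) (h W)

/-- Near every point there are smooth frames dual to each other with respect to `g`. -/
lemma exists_dual_frames (p : M) : ∃ e f : Fin (Module.finrank ℝ E) → SmoothField I M,
    ∀ᶠ q in 𝓝 p, ∀ i j, g.inner q (e i q) (f j q) = if i = j then 1 else 0 := by
  let t := trivializationAt E (fun p : M ↦ TangentSpace I p) p
  have hp : p ∈ t.baseSet := FiberBundle.mem_baseSet_trivializationAt' p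
  let b := Module.finBasis ℝ E
  have hfr := t.isLocalFrameOn_localFrame_baseSet I ∞ b
  choose e he using fun i ↦ exists_smoothField_eventuallyEq_section t.open_baseSet hp
    (hfr.contMDiffOn i)
  -- The dual frame is `G⁻¹ e` with `G` the Gram matrix. Cramer's rule, adjugate over determinant,
  -- makes its entries smooth wherever `det G ≠ 0`, in particular near `p` by positivity of `g`.
  let G : M → Matrix (Fin (Module.finrank ℝ E)) (Fin (Module.finrank ℝ E)) ℝ :=
    fun q ↦ Matrix.of fun i j ↦ g.inner q (e i q) (e j q)
  have hG : ∀ i j, ContMDiff I 𝓘(ℝ, ℝ) ∞ (fun q ↦ G q i j) := fun i j ↦ (ip g (e i) (e j)).contMDiff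
  have hdet : ∀ A : M → Matrix (Fin (Module.finrank ℝ E)) (Fin (Module.finrank ℝ E)) ℝ,
      (∀ i j, ContMDiff I 𝓘(ℝ, ℝ) ∞ (fun q ↦ A q i j)) →
      ContMDiff I 𝓘(ℝ, ℝ) ∞ (fun q ↦ (A q).det) := by
    intro A hA
    simp only [Matrix.det_apply']
    exact contMDiff_finsetSum fun σ _ ↦ contMDiff_const.mul
      (contMDiff_finsetProd fun i _ ↦ hA _ _)
  have hadj : ∀ i j, ContMDiff I 𝓘(ℝ, ℝ) ∞ (fun q ↦ (G q).adjugate i j) := by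
    intro i j
    simp only [Matrix.adjugate_apply]
    refine hdet _ fun k l ↦ ?_
    simp only [Matrix.updateRow_apply]
    split_ifs
    · exact contMDiff_const
    · exact hG _ _
  let u : Set M := {q | (G q).det ≠ 0}
  have hu : IsOpen u := isOpen_ne_fun (hdet G hG).continuous continuous_const
  have hpu : p ∈ u := by
    intro h0
    obtain ⟨c, hc0, hc⟩ := Matrix.exists_mulVec_eq_zero_iff.2 h0
    have h1 : ∑ i, c i • e i p = 0 := by
      by_contra hne
      have := g.pos p _ hne
      have h2 : g.inner p (∑ i, c i • e i p) (∑ i, c i • e i p)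
          = ∑ i, c i * (Matrix.mulVec (G p) c) i := by
        simp only [map_sum, map_smul, _root_.sum_apply, _root_.smul_apply,
          smul_eq_mul, Matrix.mulVec, dotProduct, G, Matrix.of_apply, Finset.mul_sum]
        rw [Finset.sum_comm]
        exact Finset.sum_congr rfl fun i _ ↦ Finset.sum_congr rfl fun j _ ↦ by ring
      rw [h2, hc] at this
      simp at this
    have hli := hfr.linearIndependent hp
    simp only [fun i ↦ (he i).self_of_nhds] at h1
    exact hc0 (funext (Fintype.linearIndependent_iff.1 hli c h1))
  have hinv : ∀ i j, ContMDiffOn I 𝓘(ℝ, ℝ) ∞ (fun q ↦ (G q).adjugate i j / (G q).det) u :=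
    fun i j ↦ (hadj i j).contMDiffOn.div₀ (hdet G hG).contMDiffOn fun q hq ↦ hq
  choose h hh using fun i j ↦ exists_smoothFun_eventuallyEq hu hpu (hinv i j)
  refine ⟨e, fun j ↦ ∑ k, fieldSMul (h k j) (e k), ?_⟩
  have hh' := Filter.eventually_all.2 fun i ↦ Filter.eventually_all.2 fun j ↦ hh i j
  filter_upwards [hh', hu.mem_nhds hpu] with q hq hqu i j
  have hsum : (∑ k, fieldSMul (h k j) (e k)) q = ∑ k, h k j q • e k q := by
    have := map_sum (ContMDiffSection.coeAddHom I E ∞ (fun p : M ↦ TangentSpace I p))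
      (fun k ↦ fieldSMul (h k j) (e k)) Finset.univ
    refine (congrFun this q).trans ?_
    rw [Finset.sum_apply]
    rfl
  rw [hsum]
  simp only [map_sum, map_smul, smul_eq_mul, hq]
  have hmul : (G q * (G q).adjugate) i j = (G q).det * (if i = j then 1 else 0) := by
    rw [Matrix.mul_adjugate]
    simp [Matrix.one_apply]
  rw [Matrix.mul_apply] at hmul
  have : ∑ k, (G q).adjugate k j / (G q).det * g.inner q (e i q) (e k q)
      = (∑ k, G q i k * (G q).adjugate k j) / (G q).det := by
    rw [Finset.sum_div]
    exact Finset.sum_congr rfl fun k _ ↦ by simp [G]; ring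
  rw [this, hmul]
  exact mul_div_cancel_left₀ _ hqu

/-- A vector field whose inner products with smooth vector fields are smooth is smooth. -/
lemma contMDiff_of_inner {V : Π p : M, TangentSpace I p}
    (h : ∀ Z : SmoothField I M, ContMDiff I 𝓘(ℝ, ℝ) ∞ (fun p ↦ g.inner p (V p) (Z p))) :
    ContMDiff I (I.prod 𝓘(ℝ, E)) ∞ (T% V) := by
  intro p
  obtain ⟨e, f, hef⟩ := exists_dual_frames g p
  have h1 : ContMDiffAt I (I.prod 𝓘(ℝ, E)) ∞
      (T% (fun q ↦ ∑ i, g.inner q (V q) (e i q) • f i q)) p :=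
    ContMDiffAt.sum_section fun i _ ↦
      (h (e i)).contMDiffAt.smul_section (f i).contMDiff.contMDiffAt
  refine h1.congr_of_eventuallyEq ?_
  filter_upwards [hef] with q hq
  exact congrArg (TotalSpace.mk' E q) (eq_sum_of_dual g (Fintype.card_fin _) hq (V q))

/-- The covariant derivative `∇_X Y` of smooth vector fields. -/
def nab (X Y : SmoothField I M) : SmoothField I M :=
  ⟨fun p ↦ leviCivita g Y p (X p), by
    -- The Koszul formula expresses the inner product with a smooth `Z` through smooth functions.
    refine contMDiff_of_inner g fun Z ↦ ?_
    have h := ((((dir X (ip g Y Z) + dir Y (ip g X Z) - dir Z (ip g X Y)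
      + ip g (bracket X Y) Z - ip g (bracket X Z) Y - ip g (bracket Y Z) X) :
        SmoothFun I M)).contMDiff)
    refine ((contMDiff_const (c := (2⁻¹ : ℝ))).mul h).congr fun p ↦ ?_
    have h2 := two_mul_inner_leviCivitaFun g (X.mdiffAt p) (Y.mdiffAt p) (Z.mdiffAt p)
    have h3 : g.inner p (leviCivita g Y p (X p)) (Z p) = 2⁻¹ * koszul g X Y Z p := by
      rw [← h2]
      simp [leviCivita]
    rw [h3]
    rfl⟩

lemma nab_apply (X Y : SmoothField I M) (p : M) : nab g X Y p = leviCivita g Y p (X p) := rfl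

lemma nab_add_left (X Y Z : SmoothField I M) : nab g (X + Y) Z = nab g X Z + nab g Y Z := by
  ext p
  simp [nab_apply]

lemma nab_add_right (X Y Z : SmoothField I M) : nab g X (Y + Z) = nab g X Y + nab g X Z := by
  ext p
  have := (leviCivita g).isCovariantDerivativeOnUniv.add (Y.mdiffAt p) (Z.mdiffAt p)
  exact congrArg (fun A : TangentSpace I p →L[ℝ] TangentSpace I p ↦ A (X p)) this

/-- The connection on the second argument as an additive map. -/
def nabHom (X : SmoothField I M) : SmoothField I M →+ SmoothField I M :=
  AddMonoidHom.mk' (nab g X) (nab_add_right g X)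

lemma nab_sub_right (X Y Z : SmoothField I M) : nab g X (Y - Z) = nab g X Y - nab g X Z :=
  map_sub (nabHom g X) Y Z

lemma nab_neg_right (X Y : SmoothField I M) : nab g X (-Y) = - nab g X Y :=
  map_neg (nabHom g X) Y

lemma nab_torsion (X Y : SmoothField I M) : nab g X Y - nab g Y X = bracket X Y := by
  ext p
  exact leviCivita_torsion_eq_zero g (X.mdiffAt p) (Y.mdiffAt p)

lemma dir_ip (X Y Z : SmoothField I M) :
    dir X (ip g Y Z) = ip g (nab g X Y) Z + ip g Y (nab g X Z) := by
  ext p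
  exact leviCivita_metric g (X.mdiffAt p) (Y.mdiffAt p) (Z.mdiffAt p)

end Connection

/-! ### Curvature of smooth vector fields -/

section Curvature

set_option linter.unusedSectionVars false

open scoped Topology

variable {E : Type*} [NormedAddCommGroup E] [NormedSpace ℝ E] [FiniteDimensional ℝ E]
  {H : Type*} [TopologicalSpace H] {I : ModelWithCorners ℝ E H}
  {M : Type*} [TopologicalSpace M] [ChartedSpace H M] [IsManifold I ∞ M]
  (g : ContMDiffRiemannianMetric I ∞ E (fun p : M ↦ TangentSpace I p))

lemma leviCivita_congr {Y Y' : Π p : M, TangentSpace I p} {p : M}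
    (hY : MDiffAt (T% Y) p) (hY' : MDiffAt (T% Y') p) (h : ∀ᶠ q in 𝓝 p, Y q = Y' q) :
    leviCivita g Y p = leviCivita g Y' p :=
  (leviCivita g).isCovariantDerivativeOnUniv.congr_of_eventuallyEq hY hY' (by simp) h

lemma nablaEnd_eq {T : Π p : M, TangentSpace I p → TangentSpace I p} {p : M}
    {v : TangentSpace I p} (u : TangentSpace I p) {Y TY : SmoothField I M}
    (hY : ∀ᶠ q in 𝓝 p, Y q = extend E v q) (hTY : ∀ q, TY q = T q (Y q)) :
    nablaEnd g T p u v = leviCivita g TY p u - T p (leviCivita g Y p u) := by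
  have hT : ∀ᶠ q in 𝓝 p, TY q = T q (extend E v q) := by
    filter_upwards [hY] with q hq
    rw [hTY, hq]
  rw [nablaEnd, ← leviCivita_congr g (Y.mdiffAt p)
    (mdifferentiableAt_extend (I := I) (F := E) v) hY, ← leviCivita_congr g (TY.mdiffAt p)
    ((TY.mdiffAt p).congr_of_eventuallyEq (hT.mono fun r hr ↦ by simp [hr])) hT]

variable [T2Space M]

/-- The smooth vector field `R(X, Y)Z`. -/
def curv (X Y Z : SmoothField I M) : SmoothField I M :=
  nab g X (nab g Y Z) - nab g Y (nab g X Z) - nab g (bracket X Y) Z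

lemma nab_neg_left (X Z : SmoothField I M) : nab g (-X) Z = - nab g X Z := by
  ext p
  simp [nab_apply]

lemma curv_swap (X Y Z : SmoothField I M) : curv g X Y Z = - curv g Y X Z := by
  simp only [curv]
  rw [bracket_swap X Y, nab_neg_left]
  abel

/-- Metric compatibility turns `[X, Y] f = X(Yf) - Y(Xf)` for `f = g(Z, W)` into this skew-symmetry.
-/
lemma ip_curv_right (X Y Z W : SmoothField I M) :
    ip g (curv g X Y Z) W = - ip g Z (curv g X Y W) := by
  have h := dir_bracket X Y (ip g Z W)
  simp only [dir_ip, dir_add] at h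
  simp only [curv, ip_sub_left, ip_sub_right]
  linear_combination -h

/-- The Jacobi identity with every bracket rewritten by vanishing torsion. -/
lemma curv_bianchi (X Y Z : SmoothField I M) :
    curv g X Y Z + curv g Y Z X + curv g Z X Y = 0 := by
  have h := bracket_jacobi X Y Z
  have e : ∀ A B C : SmoothField I M, bracket A (bracket B C)
      = nab g A (nab g B C) - nab g A (nab g C B) - nab g (bracket B C) A := by
    intro A B C
    rw [← nab_torsion g A, ← nab_torsion g B C, nab_sub_right]
  rw [bracket_swap (bracket X Y) Z, bracket_swap X Z, e X Y Z, e Z X Y] at h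
  have e' : bracket Y (-bracket Z X) = - bracket Y (bracket Z X) := by
    rw [← nab_torsion g, nab_neg_left, nab_neg_right, ← nab_torsion g Y]
    abel
  rw [e', e Y Z X, ← sub_eq_zero] at h
  simp only [curv]
  rw [← h]
  abel

/-- The classical octahedron argument: four Bianchi identities combined with the two
skew-symmetries. -/
lemma pair_symm_of_bianchi {α : Type*} {r : α → α → α → α → ℝ}
    (h12 : ∀ a b c d, r a b c d = - r b a c d) (h34 : ∀ a b c d, r a b c d = - r a b d c)
    (hB : ∀ a b c d, r a b c d + r b c a d + r c a b d = 0) (a b c d : α) :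
    r a b c d = r c d a b := by
  linarith [hB a b c d, hB b c d a, hB c d a b, hB d a b c, h12 a b c d, h34 a b c d,
    h12 b c a d, h34 b c a d, h12 c a b d, h34 c a b d, h12 b c d a, h12 c d b a, h12 d b c a,
    h34 c d b a, h34 d b c a, h12 c d a b, h12 d a c b, h12 a c d b, h34 d a c b, h34 a c d b,
    h12 d a b c, h12 a b d c, h12 b d a c, h34 b d a c, h34 d a b c, h12 b d c a, h34 a c b d,
    h12 c a d b]

lemma ip_curv_pair (X Y Z W : SmoothField I M) (p : M) :
    ip g (curv g X Y Z) W p = ip g (curv g Z W X) Y p := by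
  refine pair_symm_of_bianchi (r := fun X Y Z W ↦ ip g (curv g X Y Z) W p) ?_ ?_ ?_ X Y Z W
  · intro a b c d
    rw [curv_swap, ip_neg_left]
    rfl
  · intro a b c d
    rw [ip_curv_right, ip_comm]
    rfl
  · intro a b c d
    have := congrArg (fun f : SmoothFun I M ↦ f p)
      (congrArg (fun X ↦ ip g X d) (curv_bianchi g a b c))
    simp only [ip_add_left] at this
    refine this.trans ?_
    simp [ip_apply]

/-- Tensoriality without Leibniz computations: skew-symmetry moves the third argument into a slot of
`g`, where only its value at `p` counts, and pair symmetry reduces the first two arguments to that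
case. -/
lemma curv_congr {X X' Y Y' Z Z' : SmoothField I M} {p : M} (hX : X p = X' p) (hY : Y p = Y' p)
    (hZ : Z p = Z' p) : curv g X Y Z p = curv g X' Y' Z' p := by
  have h3 : ∀ (A B : SmoothField I M) {C C' : SmoothField I M}, C p = C' p →
      curv g A B C p = curv g A B C' p := by
    intro A B C C' h
    refine eq_of_inner_eq g fun w ↦ ?_
    obtain ⟨W, rfl⟩ := exists_smoothField_apply_eq w
    have e : ∀ C, g.inner p (curv g A B C p) (W p) = - g.inner p (C p) (curv g A B W p) :=
      fun C ↦ congrArg (fun f : SmoothFun I M ↦ f p) (ip_curv_right g A B C W)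
    rw [e, e, h]
  refine eq_of_inner_eq g fun w ↦ ?_
  obtain ⟨W, rfl⟩ := exists_smoothField_apply_eq w
  calc g.inner p (curv g X Y Z p) (W p) = g.inner p (curv g X Y Z' p) (W p) := by rw [h3 X Y hZ]
    _ = g.inner p (curv g Z' W X p) (Y p) := ip_curv_pair g X Y Z' W p
    _ = g.inner p (curv g Z' W X' p) (Y' p) := by rw [h3 Z' W hX, hY]
    _ = g.inner p (curv g X' Y' Z' p) (W p) := ip_curv_pair g Z' W X' Y' p

/-- Passage from the pointwise definition by local extensions to global fields: replace the
extensions by global fields with the same germs, then use tensoriality. -/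
lemma curvature_eq_curv (X Y Z : SmoothField I M) (p : M) :
    curvature g p (X p) (Y p) (Z p) = curv g X Y Z p := by
  obtain ⟨X', hX⟩ := exists_smoothField_extend (X p)
  obtain ⟨Y', hY⟩ := exists_smoothField_extend (Y p)
  obtain ⟨Z', hZ⟩ := exists_smoothField_extend (Z p)
  have hX0 : X' p = X p := by simpa using hX.self_of_nhds
  have hY0 : Y' p = Y p := by simpa using hY.self_of_nhds
  have hZ0 : Z' p = Z p := by simpa using hZ.self_of_nhds
  have key : ∀ {A : SmoothField I M} {u : TangentSpace I p} (_ : ∀ᶠ q in 𝓝 p, A q = extend E u q)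
      (v : TangentSpace I p),
      leviCivita g (fun q ↦ leviCivita g (extend E (Z p)) q (extend E u q)) p v
        = leviCivita g (nab g A Z') p v := by
    intro A u hA v
    have he : ∀ᶠ q in 𝓝 p, nab g A Z' q = leviCivita g (extend E (Z p)) q (extend E u q) := by
      filter_upwards [hA, hZ.eventually_nhds] with q hq hZq
      have hd : MDiffAt (T% (extend E (Z p))) q :=
        (Z'.mdiffAt q).congr_of_eventuallyEq (hZq.mono fun r hr ↦ by simp [hr])
      rw [nab_apply, hq, leviCivita_congr g (Z'.mdiffAt q) hd hZq]
    rw [leviCivita_congr g ((nab g A Z').mdiffAt p) _ he]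
    exact ((nab g A Z').mdiffAt p).congr_of_eventuallyEq (he.mono fun r hr ↦ by simp [hr])
  rw [← curv_congr g hX0 hY0 hZ0]
  have hbr : mlieBracket I X' Y' p = mlieBracket I (extend E (X p)) (extend E (Y p)) p :=
    Filter.EventuallyEq.mlieBracket_vectorField_eq hX hY
  simp only [curvature, curvatureField]
  rw [key hX, key hY, ← hbr,
    ← leviCivita_congr g (Z'.mdiffAt p) (mdifferentiableAt_extend (I := I) (F := E) (Z p)) hZ]
  simp only [extend_apply_self, ← hX0, ← hY0]
  rfl

end Curvature

/-! ### The Ricci tensor in a pair of dual frames -/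

section Ricci

set_option linter.unusedSectionVars false

open scoped Topology

variable {E : Type*} [NormedAddCommGroup E] [NormedSpace ℝ E] [FiniteDimensional ℝ E]
  {H : Type*} [TopologicalSpace H] {I : ModelWithCorners ℝ E H}
  {M : Type*} [TopologicalSpace M] [ChartedSpace H M] [IsManifold I ∞ M]
  (g : ContMDiffRiemannianMetric I ∞ E (fun p : M ↦ TangentSpace I p))

lemma trace_eq_sum_of_dual {ι : Type*} [Fintype ι] [DecidableEq ι] {p : M}
    (hι : Fintype.card ι = Module.finrank ℝ (TangentSpace I p))
    {e f : ι → TangentSpace I p} (h : ∀ i j, g.inner p (e i) (f j) = if i = j then 1 else 0)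
    (T : TangentSpace I p →ₗ[ℝ] TangentSpace I p) :
    LinearMap.trace ℝ (TangentSpace I p) T = ∑ i, g.inner p (T (f i)) (e i) := by
  have hli : LinearIndependent ℝ f := by
    rw [Fintype.linearIndependent_iff]
    intro c hc j
    have := congrArg (g.inner p (e j)) hc
    simpa [h] using this
  let b := basisOfLinearIndependentOfCardEqFinrank' f hli hι
  have hb : ∀ i, b i = f i := fun i ↦ by simp [b]
  rw [LinearMap.trace_eq_matrix_trace ℝ b T, Matrix.trace]
  refine Finset.sum_congr rfl fun i _ ↦ ?_
  rw [Matrix.diag_apply, LinearMap.toMatrix_apply, hb]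
  conv_rhs => rw [← b.sum_repr (T (f i))]
  rw [g.symm]
  simp [hb, h]

variable [T2Space M]

/-- Exhibits `u` as an argument of `g` itself, which yields the linearity of `u ↦ R(u, v)w`. -/
lemma inner_curvature (p : M) (u v w z : TangentSpace I p) :
    g.inner p (curvature g p u v w) z = - g.inner p u (curvature g p w z v) := by
  obtain ⟨X, rfl⟩ := exists_smoothField_apply_eq u
  obtain ⟨Y, rfl⟩ := exists_smoothField_apply_eq v
  obtain ⟨Z, rfl⟩ := exists_smoothField_apply_eq w
  obtain ⟨W, rfl⟩ := exists_smoothField_apply_eq z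
  rw [curvature_eq_curv, curvature_eq_curv]
  exact (ip_curv_pair g X Y Z W p).trans
    (congrArg (fun f : SmoothFun I M ↦ f p) (ip_curv_right g Z W X Y))

lemma inner_curvature_skew (p : M) (u v w z : TangentSpace I p) :
    g.inner p (curvature g p u v w) z = - g.inner p w (curvature g p u v z) := by
  obtain ⟨X, rfl⟩ := exists_smoothField_apply_eq u
  obtain ⟨Y, rfl⟩ := exists_smoothField_apply_eq v
  obtain ⟨Z, rfl⟩ := exists_smoothField_apply_eq w
  obtain ⟨W, rfl⟩ := exists_smoothField_apply_eq z
  rw [curvature_eq_curv, curvature_eq_curv]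
  exact congrArg (fun f : SmoothFun I M ↦ f p) (ip_curv_right g X Y Z W)

/-- The linear map `u ↦ R(u, v)w`. -/
def curvatureLinear (p : M) (v w : TangentSpace I p) : TangentSpace I p →ₗ[ℝ] TangentSpace I p where
  toFun u := curvature g p u v w
  map_add' u u' := by
    refine eq_of_inner_eq g fun z ↦ ?_
    simp only [map_add, _root_.add_apply, inner_curvature g p _ v w z]
    ring
  map_smul' c u := by
    refine eq_of_inner_eq g fun z ↦ ?_
    simp only [map_smul, _root_.smul_apply, inner_curvature g p _ v w z, RingHom.id_apply,
      smul_eq_mul]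
    ring

lemma ricci_eq_trace (p : M) (v w : TangentSpace I p) :
    ricci g p v w = LinearMap.trace ℝ (TangentSpace I p) (curvatureLinear g p v w) := by
  rw [LinearMap.trace_eq_matrix_trace ℝ (Module.finBasis ℝ (TangentSpace I p)), Matrix.trace]
  refine Finset.sum_congr rfl fun i _ ↦ ?_
  rw [Matrix.diag_apply, LinearMap.toMatrix_apply]
  rfl

/-- A variation `(e', f')` of dual families `(e, f)` that keeps them dual to first order does not
change `∑ g(T (f i), e i) = tr T`. -/
lemma sum_dual_variation {ι : Type*} [Fintype ι] [DecidableEq ι] {p : M}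
    (hι : Fintype.card ι = Module.finrank ℝ (TangentSpace I p))
    {e f e' f' : ι → TangentSpace I p}
    (h : ∀ i j, g.inner p (e i) (f j) = if i = j then 1 else 0)
    (h' : ∀ i j, g.inner p (e' i) (f j) + g.inner p (e i) (f' j) = 0)
    (T : TangentSpace I p →ₗ[ℝ] TangentSpace I p) :
    ∑ i, (g.inner p (T (f' i)) (e i) + g.inner p (T (f i)) (e' i)) = 0 := by
  have h2 : ∀ i j, g.inner p (f i) (e j) = if i = j then 1 else 0 := fun i j ↦ by
    rw [g.symm, h]
    simp only [eq_comm]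
  -- Expand `e' i` in the `e j` and `f' j` in the `f i`. First-order duality makes the coefficient
  -- matrices opposite up to transposition, so the two double sums cancel.
  have he : ∀ i, g.inner p (T (f i)) (e' i)
      = - ∑ j, g.inner p (f' j) (e i) * g.inner p (T (f i)) (e j) := by
    intro i
    rw [eq_sum_of_dual g hι h2 (e' i), map_sum, ← Finset.sum_neg_distrib]
    refine Finset.sum_congr rfl fun j _ ↦ ?_
    rw [map_smul, smul_eq_mul, g.symm p (f' j)]
    linear_combination (g.inner p (T (f i)) (e j)) * h' i j
  have hf : ∀ j, g.inner p (T (f' j)) (e j)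
      = ∑ i, g.inner p (f' j) (e i) * g.inner p (T (f i)) (e j) := by
    intro j
    rw [eq_sum_of_dual g hι h (f' j)]
    simp only [map_sum, map_smul, _root_.sum_apply, _root_.smul_apply, smul_eq_mul]
    refine Finset.sum_congr rfl fun i _ ↦ ?_
    congr 1
    have := congrArg (fun v ↦ g.inner p v (e i)) (eq_sum_of_dual g hι h (f' j))
    simp only [map_sum, map_smul, _root_.sum_apply, _root_.smul_apply, smul_eq_mul] at this
    exact this
  rw [Finset.sum_add_distrib]
  simp only [he, hf, Finset.sum_neg_distrib]
  rw [Finset.sum_comm]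
  ring

end Ricci

/-! ### Riemannian Π-structures acting on smooth vector fields -/

namespace PiStructure

set_option linter.unusedSectionVars false

open scoped Topology

variable {E : Type*} [NormedAddCommGroup E] [NormedSpace ℝ E] [FiniteDimensional ℝ E]
  {H : Type*} [TopologicalSpace H] {I : ModelWithCorners ℝ E H}
  {M : Type*} [TopologicalSpace M] [ChartedSpace H M] [IsManifold I ∞ M]
  {g : ContMDiffRiemannianMetric I ∞ E (fun p : M ↦ TangentSpace I p)} (S : PiStructure g)

lemma inner_ξ (p : M) (x : TangentSpace I p) : g.inner p x (S.ξ p) = S.η p x := by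
  have := S.inner_φ_φ p x (S.ξ p)
  rw [S.φ_ξ, S.η_ξ, map_zero] at this
  linarith

lemma inner_ξ_left (p : M) (x : TangentSpace I p) : g.inner p (S.ξ p) x = S.η p x := by
  rw [g.symm, S.inner_ξ]

lemma inner_φ_right (p : M) (x y : TangentSpace I p) :
    g.inner p x (S.φ p y) = g.inner p (S.φ p x) y := by
  have := S.inner_φ_φ p (S.φ p x) y
  rw [S.φ_φ, S.η_φ, map_sub, map_smul, _root_.sub_apply, _root_.smul_apply, S.inner_ξ_left,
    S.η_φ] at this
  simpa using this

lemma trace_φ_φ (p : M) : LinearMap.trace ℝ (TangentSpace I p)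
    ((S.φ p).toLinearMap ∘ₗ (S.φ p).toLinearMap) = Module.finrank ℝ E - 1 := by
  have h : (S.φ p).toLinearMap ∘ₗ (S.φ p).toLinearMap
      = LinearMap.id - (S.η p).toLinearMap.smulRight (S.ξ p) := by
    ext x
    exact S.φ_φ p x
  rw [h, map_sub, LinearMap.trace_smulRight, LinearMap.trace_id]
  congr 1
  exact S.η_ξ p

/-- `φ` and `φ²` are linearly independent in dimension greater than one. -/
lemma eq_zero_of_smul_φ_add (hE : 1 < Module.finrank ℝ E) (p : M) {a b : ℝ}
    (h : ∀ x y : TangentSpace I p,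
      a * g.inner p (S.φ p x) y + b * g.inner p (S.φ p x) (S.φ p y) = 0) : a = 0 ∧ b = 0 := by
  have h1 : a • (S.φ p).toLinearMap + b • ((S.φ p).toLinearMap ∘ₗ (S.φ p).toLinearMap) = 0 := by
    ext x
    refine eq_of_inner_eq g fun y ↦ ?_
    have := h x y
    rw [S.inner_φ_right] at this
    simpa using this
  have hn : (Module.finrank ℝ E : ℝ) - 1 ≠ 0 := by
    have : (1 : ℝ) < Module.finrank ℝ E := by exact_mod_cast hE
    linarith
  -- Since `tr φ = 0` and `tr φ² = dim - 1 ≠ 0`, the trace gives `b = 0`; composing the rest with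
  -- `φ` and taking the trace again gives `a = 0`.
  have h2 := congrArg (LinearMap.trace ℝ (TangentSpace I p)) h1
  rw [map_add, map_smul, map_smul, S.trace_φ, S.trace_φ_φ, map_zero, smul_zero, zero_add,
    smul_eq_mul] at h2
  have hb : b = 0 := (mul_eq_zero.1 h2).resolve_right hn
  refine ⟨?_, hb⟩
  rw [hb, zero_smul, add_zero] at h1
  have h3 := congrArg (fun T ↦ LinearMap.trace ℝ (TangentSpace I p) (T ∘ₗ (S.φ p).toLinearMap)) h1
  simp only [LinearMap.smul_comp, map_smul, S.trace_φ_φ, LinearMap.zero_comp, map_zero,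
    smul_eq_mul] at h3
  exact (mul_eq_zero.1 h3).resolve_right hn

/-- The smooth vector field `ξ`. -/
def xi : SmoothField I M := ⟨S.ξ, S.smooth_ξ⟩

/-- The smooth vector field `φ X`. -/
def phi (X : SmoothField I M) : SmoothField I M :=
  ⟨fun p ↦ S.φ p (X p), ContMDiff.clm_bundle_apply S.smooth_φ X.contMDiff⟩

lemma xi_apply (p : M) : S.xi p = S.ξ p := rfl

lemma phi_apply (X : SmoothField I M) (p : M) : S.phi X p = S.φ p (X p) := rfl

lemma phi_sub (X Y : SmoothField I M) : S.phi (X - Y) = S.phi X - S.phi Y := by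
  ext p
  exact map_sub (S.φ p) _ _

lemma phi_xi : S.phi S.xi = 0 := by
  ext p
  exact S.φ_ξ p

lemma ip_phi_right (X Y : SmoothField I M) : ip g X (S.phi Y) = ip g (S.phi X) Y := by
  ext p
  exact S.inner_φ_right p _ _

lemma ip_phi_xi (X : SmoothField I M) : ip g (S.phi X) S.xi = 0 := by
  rw [← ip_phi_right, phi_xi]
  ext p
  exact map_zero (g.inner p (X p))

lemma ip_xi_xi : ip g S.xi S.xi = 1 := by
  ext p
  exact (S.inner_ξ p _).trans (S.η_ξ p)

lemma two_mul_mul_apply (a b : SmoothFun I M) (p : M) : (2 * a * b) p = 2 * a p * b p := by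
  rw [← one_add_one_eq_two]
  change (1 + 1) * a p * b p = _
  ring

variable [T2Space M]

lemma dir_one (X : SmoothField I M) : dir X 1 = 0 := by
  have := dir_mul X 1 1
  rw [mul_one, one_mul] at this
  linear_combination -this

/-- Tensoriality of `∇φ` in `Y`: metric compatibility and the symmetry of `φ` shift all derivatives
from `Y` to a test field. -/
lemma nab_phi_sub_congr (X : SmoothField I M) {Y Y' : SmoothField I M} {p : M} (h : Y p = Y' p) :
    nab g X (S.phi Y) p - S.φ p (nab g X Y p) = nab g X (S.phi Y') p - S.φ p (nab g X Y' p) := by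
  refine eq_of_inner_eq g fun w ↦ ?_
  obtain ⟨W, rfl⟩ := exists_smoothField_apply_eq w
  have e : ∀ Z, g.inner p (nab g X (S.phi Z) p - S.φ p (nab g X Z p)) (W p)
      = g.inner p (Z p) (nab g X (S.phi W) p) - g.inner p (S.φ p (Z p)) (nab g X W p) := by
    intro Z
    have h1 := dir_ip g X (S.phi Z) W
    have h2 := dir_ip g X Z (S.phi W)
    rw [S.ip_phi_right, h1] at h2
    have h3 := congrArg (fun f : SmoothFun I M ↦ f p) h2
    change g.inner p (nab g X (S.phi Z) p) (W p) + g.inner p (S.φ p (Z p)) (nab g X W p)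
      = g.inner p (nab g X Z p) (S.φ p (W p)) + g.inner p (Z p) (nab g X (S.phi W) p) at h3
    rw [S.inner_φ_right] at h3
    rw [map_sub, _root_.sub_apply]
    linarith
  rw [e, e, h]

variable {S} (hS : S.IsParaSasakiLike)

include hS

lemma nab_phi (X Y : SmoothField I M) : nab g X (S.phi Y) - S.phi (nab g X Y)
    = - fieldSMul (ip g X Y) S.xi - fieldSMul (ip g Y S.xi) X
      + fieldSMul (2 * ip g X S.xi * ip g Y S.xi) S.xi := by
  ext p
  obtain ⟨Y', hY'⟩ := exists_smoothField_extend (Y p)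
  have hp : Y' p = Y p := by simpa using hY'.self_of_nhds
  have h := hS p (X p) (Y p)
  rw [nablaEnd_eq g (T := fun q v ↦ S.φ q v) (X p) hY' (TY := S.phi Y') fun q ↦ rfl] at h
  have h2 := S.nab_phi_sub_congr X hp
  simp only [nab_apply] at h2
  rw [h2, ← S.inner_ξ, ← S.inner_ξ] at h
  refine h.trans ?_
  rw [← xi_apply, ← ip_apply, ← ip_apply, ← ip_apply, ← two_mul_mul_apply]
  rfl

/-- `∇_X ξ = φ X`. -/
lemma nab_xi (X : SmoothField I M) : nab g X S.xi = S.phi X := by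
  have h := nab_phi hS X S.xi
  have h0 : nab g X (S.phi S.xi) = 0 := by
    rw [phi_xi]
    exact map_zero (nabHom g X)
  have h1 := dir_ip g X S.xi S.xi
  rw [ip_xi_xi, dir_one, ip_comm g S.xi] at h1
  ext p
  have h2 := congrArg (fun f : SmoothFun I M ↦ f p) h1
  change (0 : ℝ) = g.inner p (nab g X S.xi p) (S.ξ p) + g.inner p (nab g X S.xi p) (S.ξ p) at h2
  rw [S.inner_ξ] at h2
  -- For `Y = ξ` the structure equation reads `φ(∇_X ξ) = φ² X`. Applying `φ` recovers `∇_X ξ`,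
  -- because `η(∇_X ξ) = 0` by `g(ξ, ξ) = 1`.
  have h3 := congrArg (fun Y : SmoothField I M ↦ S.φ p (Y p)) h
  rw [h0] at h3
  change S.φ p _ = S.φ p (_ - _ + (2 * ip g X S.xi * ip g S.xi S.xi) p • S.ξ p) at h3
  rw [two_mul_mul_apply] at h3
  change S.φ p (0 - S.φ p (nab g X S.xi p)) = S.φ p (-(g.inner p (X p) (S.ξ p) • S.ξ p)
    - g.inner p (S.ξ p) (S.ξ p) • X p
    + (2 * g.inner p (X p) (S.ξ p) * g.inner p (S.ξ p) (S.ξ p)) • S.ξ p) at h3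
  have h4 : S.η p (nab g X S.xi p) = 0 := by linarith
  simp only [map_add, map_sub, map_neg, map_smul, S.φ_ξ, S.φ_φ, S.inner_ξ, S.η_ξ, h4] at h3
  rw [phi_apply]
  simpa using h3

lemma bracket_xi (X : SmoothField I M) : bracket S.xi X = nab g S.xi X - S.phi X := by
  rw [← nab_torsion g, nab_xi hS]

/-- `R(X, Y)ξ = η(X) Y - η(Y) X`. -/
lemma curv_xi (X Y : SmoothField I M) :
    curv g X Y S.xi = fieldSMul (ip g X S.xi) Y - fieldSMul (ip g Y S.xi) X := by
  have h1 := nab_phi hS X Y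
  have h2 := nab_phi hS Y X
  have h3 : ∀ (f f' : SmoothFun I M) (A B C D : SmoothField I M), f = f' →
    (-fieldSMul f A - B + C) - (-fieldSMul f' A - D + C) = D - B := by
    rintro f f' A B C D rfl
    abel
  have h4 : 2 * ip g X S.xi * ip g Y S.xi = 2 * ip g Y S.xi * ip g X S.xi := by ring
  rw [h4] at h1
  -- With `∇ξ = φ` and no torsion, `R(X, Y)ξ = (∇_X φ)Y - (∇_Y φ)X`; the terms symmetric in `X, Y`
  -- drop out.
  rw [← h3 _ _ S.xi (fieldSMul (ip g Y S.xi) X) _ _ (ip_comm g X Y), ← h1, ← h2]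
  simp only [curv, nab_xi hS, ← nab_torsion g X Y, phi_sub]
  abel

lemma ip_curv_xi_left (X Z W : SmoothField I M) :
    ip g (curv g S.xi X Z) W = ip g Z S.xi * ip g X W - ip g X Z * ip g S.xi W := by
  ext p
  rw [ip_curv_pair, curv_xi hS, ip_sub_left, ip_fieldSMul_left, ip_fieldSMul_left, ip_comm g W X,
    ip_comm g Z X, ip_comm g W S.xi]
  change _ = (ip g Z S.xi * ip g X W - ip g X Z * ip g S.xi W) p
  congr 1
  ring

/-- The derivative of the connection along `ξ`. -/
def lieNab (S : PiStructure g) (X Z : SmoothField I M) : SmoothField I M :=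
  fieldSMul (-2 * (ip g X Z - ip g X S.xi * ip g Z S.xi)) S.xi

/-- The general formula `(L_ξ ∇)(X, Z) = R(ξ, X)Z + ∇²_{X,Z} ξ`, where the Hessian term is `(∇_X
φ)Z` because `∇ξ = φ`. -/
lemma bracket_xi_nab (X Z : SmoothField I M) :
    bracket S.xi (nab g X Z)
      = nab g X (bracket S.xi Z) + nab g (bracket S.xi X) Z + lieNab S X Z := by
  have h1 : curv g S.xi X Z + (nab g X (S.phi Z) - S.phi (nab g X Z)) = lieNab S X Z := by
    refine eq_of_ip_eq g fun W ↦ ?_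
    rw [nab_phi hS]
    simp only [lieNab, ip_add_left, ip_sub_left, ip_neg_left, ip_fieldSMul_left,
      ip_curv_xi_left hS]
    ring
  rw [← h1, bracket_xi hS, bracket_xi hS Z, nab_sub_right, curv]
  abel

end PiStructure

/-! ### The Ricci tensor of a para-Sasaki-like manifold is invariant along `ξ` -/

namespace PiStructure

set_option linter.unusedSectionVars false

open scoped Topology

variable {E : Type*} [NormedAddCommGroup E] [NormedSpace ℝ E] [FiniteDimensional ℝ E]
  {H : Type*} [TopologicalSpace H] {I : ModelWithCorners ℝ E H}
  {M : Type*} [TopologicalSpace M] [ChartedSpace H M] [IsManifold I ∞ M]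
  {g : ContMDiffRiemannianMetric I ∞ E (fun p : M ↦ TangentSpace I p)} {S : PiStructure g}

/-- Evaluation of smooth functions at a point. -/
def evalAt (p : M) : SmoothFun I M →+* ℝ := ContMDiffMap.evalRingHom p

lemma apply_eq_evalAt (a : SmoothFun I M) (p : M) : a p = evalAt p a := rfl

/-- The derivative along a vector field as an additive map. -/
def dirHom (X : SmoothField I M) : SmoothFun I M →+ SmoothFun I M :=
  AddMonoidHom.mk' (dir X) (dir_add X)

lemma dir_sub (X : SmoothField I M) (a b : SmoothFun I M) :
    dir X (a - b) = dir X a - dir X b :=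
  map_sub (dirHom X) a b

variable [T2Space M]

lemma dir_neg_two (X : SmoothField I M) : dir X (-2) = 0 := by
  have h : (-2 : SmoothFun I M) = -(1 + 1) := by norm_num
  rw [h]
  refine (map_neg (dirHom X) _).trans ?_
  change - dir X (1 + 1) = 0
  rw [dir_add, dir_one, add_zero, neg_zero]

lemma dir_congr (X : SmoothField I M) {a b : SmoothFun I M} {p : M}
    (h : ∀ᶠ q in 𝓝 p, a q = b q) : dir X a p = dir X b p := by
  simp only [dir_apply, mvfderiv, Filter.EventuallyEq.mfderiv_eq h]
  rw [h.self_of_nhds]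

lemma smoothFun_sum_apply {ι : Type*} (s : Finset ι) (a : ι → SmoothFun I M) (q : M) :
    (∑ i ∈ s, a i) q = ∑ i ∈ s, a i q := by
  have := congrFun (map_sum (ContMDiffMap.coeFnAddMonoidHom (I := I) (N := M) (n := ∞)) a s) q
  exact this.trans (Finset.sum_apply _ _ _)

lemma nab_fieldSMul_right (X Y : SmoothField I M) (f : SmoothFun I M) :
    nab g X (fieldSMul f Y) = fieldSMul (dir X f) Y + fieldSMul f (nab g X Y) := by
  ext p
  have := (leviCivita g).isCovariantDerivativeOnUniv.leibniz (Y.mdiffAt p) (f.mdiffAt p)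
  refine (congrArg (fun A : TangentSpace I p →L[ℝ] TangentSpace I p ↦ A (X p)) this).trans ?_
  exact add_comm _ _

variable (hS : S.IsParaSasakiLike)

include hS

lemma dir_xi_ip (X Y : SmoothField I M) : dir S.xi (ip g X Y)
    = ip g (bracket S.xi X) Y + ip g X (bracket S.xi Y) + 2 * ip g (S.phi X) Y := by
  rw [dir_ip, bracket_xi hS, bracket_xi hS, ip_sub_left, ip_sub_right, ip_phi_right]
  ring

lemma dir_ip_xi (X Y : SmoothField I M) :
    dir X (ip g Y S.xi) = ip g (nab g X Y) S.xi + ip g (S.phi X) Y := by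
  rw [dir_ip, nab_xi hS, ip_comm g Y]

/-- `L_ξ R` is the exterior covariant derivative of `L_ξ ∇`; the last bracket is its expansion. -/
lemma bracket_xi_curv (X Y Z : SmoothField I M) : bracket S.xi (curv g X Y Z)
    = curv g (bracket S.xi X) Y Z + curv g X (bracket S.xi Y) Z + curv g X Y (bracket S.xi Z)
      + (nab g X (lieNab S Y Z) + lieNab S X (nab g Y Z) - nab g Y (lieNab S X Z)
        - lieNab S Y (nab g X Z) - lieNab S (bracket X Y) Z) := by
  have hsub : ∀ A B : SmoothField I M,
      bracket S.xi (A - B) = bracket S.xi A - bracket S.xi B := by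
    intro A B
    simp only [bracket_xi hS, nab_sub_right, phi_sub]
    abel
  simp only [curv, hsub, bracket_xi_nab hS, nab_add_right, bracket_jacobi S.xi X Y, nab_add_left]
  abel

lemma ip_bracket_xi_curv (X Y Z W : SmoothField I M) : ip g (bracket S.xi (curv g X Y Z)) W
    = ip g (curv g (bracket S.xi X) Y Z) W + ip g (curv g X (bracket S.xi Y) Z) W
      + ip g (curv g X Y (bracket S.xi Z)) W
      + 2 * (ip g Y S.xi * ip g (S.phi X) Z - ip g X S.xi * ip g (S.phi Y) Z) * ip g S.xi W
      - 2 * (ip g Y Z - ip g Y S.xi * ip g Z S.xi) * ip g (S.phi X) W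
      + 2 * (ip g X Z - ip g X S.xi * ip g Z S.xi) * ip g (S.phi Y) W := by
  rw [bracket_xi_curv hS, ← nab_torsion g X Y]
  simp only [lieNab, nab_fieldSMul_right, nab_xi hS, ip_add_left, ip_sub_left, ip_fieldSMul_left,
    dir_neg_two, dir_sub, dir_mul, dir_ip_xi hS]
  simp only [dir_ip]
  rw [← S.ip_phi_right X Y, ip_comm g X (S.phi Y)]
  ring

/-- This is `L_ξ ρ = 0`. The smooth function `r` stands for `ρ(Y, Z)`, so that smoothness of `ρ`
need not be established separately. -/
lemma dir_xi_ricci (Y Z : SmoothField I M) (r : SmoothFun I M)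
    (hr : ∀ q, r q = ricci g q (Y q) (Z q)) (p : M) : dir S.xi r p
      = ricci g p (bracket S.xi Y p) (Z p) + ricci g p (Y p) (bracket S.xi Z p) := by
  obtain ⟨e, f, hef⟩ := exists_dual_frames g p
  have hric : ∀ᶠ q in 𝓝 p, ∀ Y Z : SmoothField I M,
      ricci g q (Y q) (Z q) = ∑ i, ip g (curv g (f i) Y Z) (e i) q := by
    filter_upwards [hef] with q hq Y Z
    rw [ricci_eq_trace, trace_eq_sum_of_dual g (Fintype.card_fin _) hq]
    exact Finset.sum_congr rfl fun i _ ↦ by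
      rw [ip_apply, ← curvature_eq_curv]
      rfl
  have hricp := hric.self_of_nhds
  have hefp := hef.self_of_nhds
  have h1 : dir S.xi r p = ∑ i, dir S.xi (ip g (curv g (f i) Y Z) (e i)) p := by
    rw [dir_congr (b := ∑ i, ip g (curv g (f i) Y Z) (e i)), ← smoothFun_sum_apply]
    · exact congrArg (fun a : SmoothFun I M ↦ a p) (map_sum (dirHom S.xi) _ _)
    · filter_upwards [hric] with q hq
      rw [smoothFun_sum_apply, hr, hq]
  -- Differentiate the constant pairing `g(e i, f j)` along `ξ`. The term `2g(φ·, ·)` from `L_ξ g`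
  -- is absorbed into the variation of `e i`, so `sum_dual_variation` applies.
  have h2 : ∀ i j, g.inner p ((bracket S.xi (e i) + S.phi (e i) + S.phi (e i)) p) (f j p)
      + g.inner p (e i p) (bracket S.xi (f j) p) = 0 := by
    intro i j
    have h := dir_xi_ip hS (e i) (f j)
    have h0 : dir S.xi (ip g (e i) (f j)) p = 0 := by
      rw [dir_congr (b := if i = j then 1 else 0)]
      · split_ifs
        · rw [dir_one]
          rfl
        · exact congrArg (fun a : SmoothFun I M ↦ a p) (map_zero (dirHom S.xi))
      · filter_upwards [hef] with q hq
        refine (hq i j).trans ?_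
        split_ifs <;> rfl
    rw [h, two_mul] at h0
    change g.inner p (bracket S.xi (e i) p) (f j p) + g.inner p (e i p) (bracket S.xi (f j) p)
      + (g.inner p (S.phi (e i) p) (f j p) + g.inner p (S.phi (e i) p) (f j p)) = 0 at h0
    change g.inner p (bracket S.xi (e i) p + S.phi (e i) p + S.phi (e i) p) (f j p) + _ = 0
    simp only [map_add, _root_.add_apply]
    linarith
  obtain ⟨c, hc⟩ : ∃ c : Fin (Module.finrank ℝ E) → ℝ, ∀ i, c i
      = g.inner p (curvatureLinear g p (Y p) (Z p) (bracket S.xi (f i) p)) (e i p)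
        + g.inner p (curvatureLinear g p (Y p) (Z p) (f i p))
          ((bracket S.xi (e i) + S.phi (e i) + S.phi (e i)) p) := ⟨_, fun _ ↦ rfl⟩
  have h3 : ∑ i, c i = 0 := by
    simp only [hc]
    exact sum_dual_variation g (Fintype.card_fin _) hefp h2 (curvatureLinear g p (Y p) (Z p))
  have h4 : ∀ i, dir S.xi (ip g (curv g (f i) Y Z) (e i)) p
      = ip g (curv g (f i) (bracket S.xi Y) Z) (e i) p + ip g (curv g (f i) Y (bracket S.xi Z)) (e i) p
      + c i + 2 * S.η p (Y p)
          * (g.inner p (S.φ p (Z p)) (f i p) * g.inner p (S.ξ p) (e i p))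
      - 2 * g.inner p (S.φ p (Y p)) (Z p)
          * (g.inner p (S.ξ p) (f i p) * g.inner p (S.ξ p) (e i p))
      - 2 * (g.inner p (Y p) (Z p) - S.η p (Y p) * S.η p (Z p))
          * g.inner p (S.φ p (f i p)) (e i p)
      + 2 * (g.inner p (Z p) (f i p) * g.inner p (S.φ p (Y p)) (e i p))
      - 2 * S.η p (Z p) * (g.inner p (S.ξ p) (f i p) * g.inner p (S.φ p (Y p)) (e i p)) := by
    intro i
    have hcl : ∀ X : SmoothField I M,
        curvatureLinear g p (Y p) (Z p) (X p) = curv g X Y Z p := fun X ↦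
      curvature_eq_curv g X Y Z p
    have hev : ∀ A B : SmoothField I M, evalAt (I := I) p (ip g A B)
        = g.inner p (A p) (B p) := fun A B ↦ rfl
    have hadd : (bracket S.xi (e i) + S.phi (e i) + S.phi (e i)) p
        = bracket S.xi (e i) p + S.φ p (e i p) + S.φ p (e i p) := rfl
    rw [dir_xi_ip hS, ip_bracket_xi_curv hS, hc, hcl, hcl, hadd]
    refine (apply_eq_evalAt _ p).trans ?_
    simp only [map_add, map_sub, map_mul, map_ofNat, hev, phi_apply, xi_apply, ip_apply,
      S.inner_ξ, S.inner_ξ_left]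
    rw [S.inner_φ_right p (curv g (f i) Y Z p), g.symm p (S.φ p (Z p)), S.inner_φ_right p (f i p),
      g.symm p (Z p) (f i p)]
    ring
  have hdual : ∀ v w : TangentSpace I p,
      ∑ i, g.inner p v (f i p) * g.inner p w (e i p) = g.inner p v w := by
    intro v w
    have := congrArg (g.inner p v) (eq_sum_of_dual g (Fintype.card_fin _) hefp w)
    rw [this, map_sum]
    exact Finset.sum_congr rfl fun i _ ↦ by rw [map_smul, smul_eq_mul, mul_comm]
  have htr := trace_eq_sum_of_dual g (Fintype.card_fin _) hefp (S.φ p).toLinearMap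
  rw [S.trace_φ] at htr
  have htr' : ∑ i, g.inner p (S.φ p (f i p)) (e i p) = 0 := htr.symm
  rw [h1, hricp, hricp]
  -- Of the traced correction terms, one vanishes by `tr φ = 0`, two by `η ∘ φ = 0`, and the
  -- remaining `-2g(φY, Z)` and `2g(Z, φY)` cancel.
  simp only [h4, Finset.sum_add_distrib, Finset.sum_sub_distrib, ← Finset.mul_sum, hdual, htr']
  simp only [S.inner_ξ, S.inner_ξ_left, S.η_φ, S.η_ξ]
  rw [g.symm p (Z p)]
  linear_combination h3

end PiStructure

/-! ### Para-Ricci-like solitons with vertical potential -/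

namespace PiStructure

set_option linter.unusedSectionVars false

open scoped Topology

variable {E : Type*} [NormedAddCommGroup E] [NormedSpace ℝ E] [FiniteDimensional ℝ E]
  {H : Type*} [TopologicalSpace H] {I : ModelWithCorners ℝ E H}
  {M : Type*} [TopologicalSpace M] [ChartedSpace H M] [IsManifold I ∞ M]
  {g : ContMDiffRiemannianMetric I ∞ E (fun p : M ↦ TangentSpace I p)} {S : PiStructure g}

/-- The constant function with value `a`. -/
def constFun (I : ModelWithCorners ℝ E H) (M : Type*) [TopologicalSpace M] [ChartedSpace H M]
    (a : ℝ) : SmoothFun I M :=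
  ⟨fun _ ↦ a, contMDiff_const⟩

lemma evalAt_constFun (a : ℝ) (p : M) : evalAt p (constFun I M a) = a := rfl

lemma dir_constFun (X : SmoothField I M) (a : ℝ) : dir X (constFun I M a) = 0 := by
  ext p
  change mvfderiv I (fun _ ↦ a) p (X p) = 0
  rw [mvfderiv_const]
  rfl

lemma evalAt_ip (X Y : SmoothField I M) (p : M) :
    evalAt p (ip g X Y) = g.inner p (X p) (Y p) := rfl

lemma lieDerivMetric_eq {V : Π p : M, TangentSpace I p} {p : M} (hV : MDiffAt (T% V) p)
    (x y : TangentSpace I p) : lieDerivMetric g V p x y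
      = g.inner p (leviCivita g V p x) y + g.inner p x (leviCivita g V p y) := by
  have hx := mdifferentiableAt_extend (I := I) (F := E) x
  have hy := mdifferentiableAt_extend (I := I) (F := E) y
  rw [lieDerivMetric, leviCivita_metric g hV hx hy, ← leviCivita_torsion_eq_zero g hV hx,
    ← leviCivita_torsion_eq_zero g hV hy]
  simp only [extend_apply_self, map_sub, _root_.sub_apply]
  ring

variable [T2Space M] (hS : S.IsParaSasakiLike)

include hS

lemma leviCivita_ξ (p : M) (x : TangentSpace I p) : leviCivita g S.ξ p x = S.φ p x := by
  obtain ⟨X, rfl⟩ := exists_smoothField_apply_eq x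
  exact congrArg (fun Y : SmoothField I M ↦ Y p) (nab_xi hS X)

lemma lieDerivMetric_smul_ξ (k : SmoothFun I M) (p : M) (x y : TangentSpace I p) :
    lieDerivMetric g (fun p ↦ k p • S.ξ p) p x y = 2 * k p * g.inner p (S.φ p x) y
      + mvfderiv I k p x * S.η p y + mvfderiv I k p y * S.η p x := by
  have hl : ∀ z, leviCivita g (fun p ↦ k p • S.ξ p) p z
      = k p • S.φ p z + mvfderiv I k p z • S.ξ p := by
    intro z
    have := (leviCivita g).isCovariantDerivativeOnUniv.leibniz (S.xi.mdiffAt p) (k.mdiffAt p)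
    refine (congrArg (fun A : TangentSpace I p →L[ℝ] TangentSpace I p ↦ A z) this).trans ?_
    rw [← leviCivita_ξ hS]
    rfl
  rw [lieDerivMetric_eq (V := fun p ↦ k p • S.ξ p) ((fieldSMul k S.xi).mdiffAt p), hl, hl]
  simp only [map_add, map_smul, _root_.add_apply, _root_.smul_apply, smul_eq_mul, S.inner_ξ,
    S.inner_ξ_left, S.inner_φ_right]
  ring

lemma curvature_ξ (p : M) (x y : TangentSpace I p) :
    curvature g p x y (S.ξ p) = S.η p x • y - S.η p y • x := by
  obtain ⟨X, rfl⟩ := exists_smoothField_apply_eq x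
  obtain ⟨Y, rfl⟩ := exists_smoothField_apply_eq y
  rw [← S.xi_apply, curvature_eq_curv, curv_xi hS, ← S.inner_ξ, ← S.inner_ξ]
  rfl

lemma ricci_ξ (p : M) (x : TangentSpace I p) :
    ricci g p x (S.ξ p) = (1 - Module.finrank ℝ E) * S.η p x := by
  have h : curvatureLinear g p x (S.ξ p)
      = (S.η p).toLinearMap.smulRight x - S.η p x • LinearMap.id := by
    ext u
    exact curvature_ξ hS p u x
  rw [ricci_eq_trace, h, map_sub, map_smul, LinearMap.trace_smulRight, LinearMap.trace_id]
  change S.η p x - S.η p x • (Module.finrank ℝ E : ℝ) = _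
  rw [smul_eq_mul]
  ring

/-- `L_ξ φ = 0`, because `∇_ξ φ = 0` and `∇ξ = φ` commutes with `φ`. -/
lemma bracket_xi_phi (X : SmoothField I M) : bracket S.xi (S.phi X) = S.phi (bracket S.xi X) := by
  refine eq_of_ip_eq g fun W ↦ ?_
  have h := congrArg (fun Y ↦ ip g Y W) (nab_phi hS S.xi X)
  simp only [ip_add_left, ip_sub_left, ip_neg_left, ip_fieldSMul_left, S.ip_xi_xi,
    ip_comm g S.xi X] at h
  rw [bracket_xi hS, bracket_xi hS, ip_sub_left, phi_sub, ip_sub_left]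
  linear_combination h

lemma bracket_xi_xi : bracket S.xi S.xi = 0 := by
  rw [← nab_torsion g, sub_self]

variable {k : M → ℝ} (hk : ContMDiff I 𝓘(ℝ, ℝ) ∞ k) {lam mu nu : ℝ}
  (hsol : S.IsParaRicciLikeSoliton (fun p ↦ k p • S.ξ p) lam mu nu)

include hk hsol

/-- The Ricci tensor of a soliton with vertical potential `k ξ`, and the differential of `k`. -/
lemma ricci_and_mvfderiv_of_soliton (p : M) (x y : TangentSpace I p) :
    mvfderiv I k p x = (Module.finrank ℝ E - 1 - lam - mu - nu) * S.η p x ∧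
    ricci g p x y = -lam * g.inner p x y - (k p + mu) * g.inner p (S.φ p x) y
      + (lam - (Module.finrank ℝ E - 1)) * (S.η p x * S.η p y) := by
  have h : ∀ x y : TangentSpace I p, ricci g p x y = -lam * g.inner p x y
      - (k p + mu) * g.inner p (S.φ p x) y
      - 1 / 2 * (mvfderiv I k p x * S.η p y + mvfderiv I k p y * S.η p x)
      - (mu + nu) * (S.η p x * S.η p y) := by
    intro x y
    rw [hsol p x y, assocMetric, S.inner_φ_right,
      show lieDerivMetric g (fun p ↦ k p • S.ξ p) p x y = _ from
        lieDerivMetric_smul_ξ hS ⟨k, hk⟩ p x y]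
    change -(1 / 2) * (2 * k p * g.inner p (S.φ p x) y + mvfderiv I k p x * S.η p y
      + mvfderiv I k p y * S.η p x) - _ - _ - _ = _
    ring
  -- Two computations of `ρ(x, ξ)`: from the curvature and from the soliton equation. At `x = ξ`
  -- they give `dk(ξ)`, and then all of `dk`.
  have hξ : ∀ x : TangentSpace I p, (1 - Module.finrank ℝ E) * S.η p x = -lam * S.η p x
      - 1 / 2 * (mvfderiv I k p x + mvfderiv I k p (S.ξ p) * S.η p x)
      - (mu + nu) * S.η p x := by
    intro x
    rw [← ricci_ξ hS, h, S.inner_ξ, S.inner_ξ, S.η_φ, S.η_ξ]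
    ring
  have h1 := hξ (S.ξ p)
  rw [S.η_ξ] at h1
  have hd : ∀ x, mvfderiv I k p x = (Module.finrank ℝ E - 1 - lam - mu - nu) * S.η p x := by
    intro x
    linear_combination 2 * hξ x - S.η p x * h1
  refine ⟨hd x, ?_⟩
  rw [h, hd, hd]
  ring

/-- The coefficient function of a soliton with vertical potential is constant, `k = -μ`, and
`λ = 0`. -/
lemma soliton_constants (hE : 1 < Module.finrank ℝ E) (p : M) : k p = -mu ∧ lam = 0 := by
  have hmain : ∀ p : M, k p + mu = 0 ∧
      2 * lam + (Module.finrank ℝ E - 1 - lam - mu - nu) = 0 := by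
    intro p
    suffices h : ∀ x y : TangentSpace I p,
        (2 * lam + (Module.finrank ℝ E - 1 - lam - mu - nu)) * g.inner p (S.φ p x) y
          + 2 * (k p + mu) * g.inner p (S.φ p x) (S.φ p y) = 0 by
      obtain ⟨ha, hb⟩ := S.eq_zero_of_smul_φ_add hE p h
      exact ⟨by linarith, ha⟩
    intro x y
    obtain ⟨X, rfl⟩ := exists_smoothField_apply_eq x
    obtain ⟨Y, rfl⟩ := exists_smoothField_apply_eq y
    let kf : SmoothFun I M := ⟨k, hk⟩
    have hdk : dir S.xi kf = constFun I M (Module.finrank ℝ E - 1 - lam - mu - nu) := by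
      ext q
      have := (ricci_and_mvfderiv_of_soliton hS hk hsol q (S.ξ q) (S.ξ q)).1
      rw [S.η_ξ, mul_one] at this
      exact this
    -- `L_ξ ρ = 0` applied to the explicit formula for `ρ`. Each derivative of `g` contributes
    -- `2g(φ·, ·)`, which produces the `φ` and `φ²` terms.
    have hr := dir_xi_ricci hS X Y (constFun I M (-lam) * ip g X Y
      - (kf + constFun I M mu) * ip g (S.phi X) Y
      + constFun I M (lam - (Module.finrank ℝ E - 1)) * (ip g X S.xi * ip g Y S.xi)) (fun q ↦ by
        rw [(ricci_and_mvfderiv_of_soliton hS hk hsol q (X q) (Y q)).2, ← S.inner_ξ, ← S.inner_ξ]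
        rfl) p
    rw [(ricci_and_mvfderiv_of_soliton hS hk hsol p _ _).2,
      (ricci_and_mvfderiv_of_soliton hS hk hsol p _ _).2] at hr
    simp only [dir_add, dir_sub, dir_mul, dir_constFun, dir_xi_ip hS, hdk, bracket_xi_xi hS,
      bracket_xi_phi hS, ip_phi_xi] at hr
    have hr := (apply_eq_evalAt _ p).symm.trans hr
    have hk0 : evalAt p kf = k p := rfl
    have h0 : (0 : SmoothField I M) p = 0 := rfl
    simp only [map_add, map_sub, map_mul, map_ofNat, map_zero, evalAt_ip, evalAt_constFun,
      hk0, phi_apply, xi_apply, S.inner_ξ, h0] at hr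
    have hφ := S.inner_φ_right p (S.φ p (X p)) (Y p)
    rw [hφ]
    linear_combination -hr
  -- Constancy of `k` makes `dk(ξ) = 2n - λ - μ - ν` zero, and `2λ + dk(ξ) = 0` then gives `λ = 0`.
  have hconst : k = fun _ ↦ -mu := funext fun q ↦ by linarith [(hmain q).1]
  have hd := (ricci_and_mvfderiv_of_soliton hS hk hsol p (S.ξ p) (S.ξ p)).1
  rw [S.η_ξ, mul_one, hconst, mvfderiv_const] at hd
  have hd' : (0 : ℝ) = Module.finrank ℝ E - 1 - lam - mu - nu := hd
  exact ⟨congrFun hconst p, by linarith [(hmain p).2]⟩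

lemma ricci_of_soliton (hE : 1 < Module.finrank ℝ E) (p : M) (x y : TangentSpace I p) :
    ricci g p x y = -lam * g.inner p x y
      + (lam - (Module.finrank ℝ E - 1)) * (S.η p x * S.η p y) := by
  rw [(ricci_and_mvfderiv_of_soliton hS hk hsol p x y).2, (soliton_constants hS hk hsol hE p).1]
  ring

end PiStructure

/-! ### Symmetry properties of an `η`-Einstein Ricci tensor -/

section RicciOperator

variable {E : Type*} [NormedAddCommGroup E] [NormedSpace ℝ E] [FiniteDimensional ℝ E]
  {H : Type*} [TopologicalSpace H] {I : ModelWithCorners ℝ E H}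
  {M : Type*} [TopologicalSpace M] [ChartedSpace H M] [IsManifold I ∞ M]
  (g : ContMDiffRiemannianMetric I ∞ E (fun p : M ↦ TangentSpace I p))

lemma ricciOperator_eq {p : M} {v w : TangentSpace I p}
    (h : ∀ z, ricci g p v z = g.inner p w z) : ricciOperator g p v = w := by
  rw [ricciOperator, LinearEquiv.symm_apply_eq]
  refine (Module.finBasis ℝ (TangentSpace I p)).ext fun i ↦ ?_
  rw [Module.Basis.constr_basis, h, flat_apply]

end RicciOperator

namespace PiStructure

set_option linter.unusedSectionVars false

open scoped Topology

variable {E : Type*} [NormedAddCommGroup E] [NormedSpace ℝ E] [FiniteDimensional ℝ E]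
  {H : Type*} [TopologicalSpace H] {I : ModelWithCorners ℝ E H}
  {M : Type*} [TopologicalSpace M] [ChartedSpace H M] [IsManifold I ∞ M] [T2Space M]
  {g : ContMDiffRiemannianMetric I ∞ E (fun p : M ↦ TangentSpace I p)} {S : PiStructure g}
  {a b : ℝ} (hρ : ∀ (p : M) (x y : TangentSpace I p),
    ricci g p x y = a * g.inner p x y + b * (S.η p x * S.η p y))

include hρ

lemma ricciOperator_of_etaEinstein (p : M) (x : TangentSpace I p) :
    ricciOperator g p x = a • x + (b * S.η p x) • S.ξ p := by
  refine ricciOperator_eq g fun z ↦ ?_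
  rw [hρ]
  simp only [map_add, map_smul, _root_.add_apply, _root_.smul_apply, smul_eq_mul, S.inner_ξ_left]
  ring

lemma isEinstein_iff [Nonempty M] (hE : 1 < Module.finrank ℝ E) : IsEinstein g ↔ b = 0 := by
  constructor
  · rintro ⟨c, hc⟩
    obtain ⟨p⟩ := ‹Nonempty M›
    have h : ∀ x y, c * g.inner p x y = a * g.inner p x y + b * (S.η p x * S.η p y) :=
      fun x y ↦ (hc p x y).symm.trans (hρ p x y)
    -- On the image of `φ` the `η`-term disappears; evaluation at `(ξ, ξ)` then isolates `b`.
    have hca : c - a = 0 := (S.eq_zero_of_smul_φ_add hE p (a := 0) (b := c - a) fun x y ↦ by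
      have := h (S.φ p x) (S.φ p y)
      rw [S.η_φ] at this
      linear_combination this).2
    have := h (S.ξ p) (S.ξ p)
    rw [S.inner_ξ, S.η_ξ] at this
    linarith
  · rintro rfl
    exact ⟨a, fun p x y ↦ by rw [hρ]; ring⟩

variable (hS : S.IsParaSasakiLike)

include hS

/-- Only `b η ⊗ η` contributes, since `∇g = 0`; `∇ξ = φ` gives `(∇_x η)(y) = g(φx, y)`. -/
lemma nablaForm_ricci (p : M) (x y z : TangentSpace I p) : nablaForm g (ricci g) p x y z
    = b * (g.inner p (S.φ p x) y * S.η p z + S.η p y * g.inner p (S.φ p x) z) := by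
  obtain ⟨X, rfl⟩ := exists_smoothField_apply_eq x
  obtain ⟨Y, hY⟩ := exists_smoothField_extend y
  obtain ⟨Z, hZ⟩ := exists_smoothField_extend z
  have hy : Y p = y := by simpa using hY.self_of_nhds
  have hz : Z p = z := by simpa using hZ.self_of_nhds
  let r : SmoothFun I M := constFun I M a * ip g Y Z
    + constFun I M b * (ip g Y S.xi * ip g Z S.xi)
  have hr : ∀ q, r q = ricci g q (Y q) (Z q) := by
    intro q
    rw [hρ, ← S.inner_ξ, ← S.inner_ξ]
    rfl
  have hr' : (fun q ↦ ricci g q (extend E y q) (extend E z q)) =ᶠ[𝓝 p] r := by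
    filter_upwards [hY, hZ] with q hq hq'
    rw [hr, hq, hq']
  have hd : mvfderiv I (fun q ↦ ricci g q (extend E y q) (extend E z q)) p (X p)
      = dir X r p := by
    simp only [dir_apply, mvfderiv, hr'.mfderiv_eq]
    rfl
  have hr2 : dir X r p = a * (g.inner p (nab g X Y p) (Z p) + g.inner p (Y p) (nab g X Z p))
      + b * (S.η p (Y p) * (S.η p (nab g X Z p) + g.inner p (Z p) (S.φ p (X p)))
        + S.η p (Z p) * (S.η p (nab g X Y p) + g.inner p (Y p) (S.φ p (X p)))) := by
    refine (apply_eq_evalAt (dir X r) p).trans ?_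
    simp only [r, dir_add, dir_mul, dir_constFun, dir_ip, nab_xi hS]
    simp only [map_add, map_mul, map_zero, evalAt_ip, evalAt_constFun, phi_apply, xi_apply,
      S.inner_ξ]
    ring
  rw [nablaForm, hd, ← leviCivita_congr g (Y.mdiffAt p)
    (mdifferentiableAt_extend (I := I) (F := E) y) hY, ← leviCivita_congr g (Z.mdiffAt p)
    (mdifferentiableAt_extend (I := I) (F := E) z) hZ, hr2, hρ, hρ, ← nab_apply, ← nab_apply,
    ← hy, ← hz, g.symm p (Y p) (S.φ p (X p)), g.symm p (Z p) (S.φ p (X p))]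
  ring

lemma nablaEnd_ricciOperator (p : M) (x y : TangentSpace I p) :
    nablaEnd g (ricciOperator g) p x y
      = (b * g.inner p (S.φ p x) y) • S.ξ p + (b * S.η p y) • S.φ p x := by
  obtain ⟨X, rfl⟩ := exists_smoothField_apply_eq x
  obtain ⟨Y, hY⟩ := exists_smoothField_extend y
  have hy : Y p = y := by simpa using hY.self_of_nhds
  have hQ : ∀ q, (fieldSMul (constFun I M a) Y
      + fieldSMul (constFun I M b * ip g Y S.xi) S.xi) q = ricciOperator g q (Y q) := by
    intro q
    rw [ricciOperator_of_etaEinstein hρ, ← S.inner_ξ]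
    rfl
  rw [nablaEnd_eq g (X p) hY hQ, ← nab_apply, ← nab_apply, ricciOperator_of_etaEinstein hρ]
  refine eq_of_inner_eq g fun w ↦ ?_
  obtain ⟨W, rfl⟩ := exists_smoothField_apply_eq w
  have h : g.inner p (nab g X (fieldSMul (constFun I M a) Y
      + fieldSMul (constFun I M b * ip g Y S.xi) S.xi) p) (W p)
      = a * g.inner p (nab g X Y p) (W p)
        + b * (S.η p (nab g X Y p) + g.inner p (Y p) (S.φ p (X p))) * S.η p (W p)
        + b * S.η p (Y p) * g.inner p (S.φ p (X p)) (W p) := by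
    refine (apply_eq_evalAt (ip g _ W) p).trans ?_
    simp only [nab_add_right, nab_fieldSMul_right, dir_mul, dir_constFun, nab_xi hS, dir_ip,
      ip_add_left, ip_fieldSMul_left]
    simp only [map_add, map_mul, map_zero, evalAt_ip, evalAt_constFun, phi_apply, xi_apply,
      S.inner_ξ, S.inner_ξ_left]
    ring
  rw [map_sub, _root_.sub_apply, h]
  simp only [map_add, map_smul, _root_.add_apply, _root_.smul_apply, smul_eq_mul, S.inner_ξ_left,
    ← hy, g.symm p (Y p) (S.φ p (X p))]
  ring

variable (hξ : a + b ≠ 0)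

include hξ

omit hS in
lemma ricciNonvanishing_of_etaEinstein [Nonempty M] : RicciNonvanishing g := by
  obtain ⟨p⟩ := ‹Nonempty M›
  refine ⟨p, S.ξ p, S.ξ p, ?_⟩
  rwa [hρ, S.inner_ξ, S.η_ξ, mul_one, mul_one, mul_one]

lemma isLocallyRicciPhiSymmetric_of_etaEinstein [Nonempty M] : S.IsLocallyRicciPhiSymmetric := by
  obtain ⟨p⟩ := ‹Nonempty M›
  refine ⟨⟨p, S.ξ p, fun h ↦ hξ ?_⟩, fun p x y hy ↦ ?_⟩
  · rw [ricciOperator_of_etaEinstein hρ, S.η_ξ, mul_one, ← add_smul] at h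
    have := congrArg (S.η p) h
    rwa [map_smul, S.η_ξ, map_zero, smul_eq_mul, mul_one] at this
  · rw [S.inner_ξ] at hy
    -- For `η(y) = 0` only a multiple of `ξ` remains, and `φ` kills it.
    rw [nablaEnd_ricciOperator hρ hS, hy]
    simp [S.φ_ξ]

variable [Nonempty M] (hE : 1 < Module.finrank ℝ E)

include hE

omit hξ in
lemma isLocallyRicciSymmetric_iff : IsLocallyRicciSymmetric g ↔ b = 0 := by
  constructor
  · intro h
    obtain ⟨p⟩ := ‹Nonempty M›
    refine (S.eq_zero_of_smul_φ_add hE p (a := b) (b := 0) fun x y ↦ ?_).1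
    have := h p x y (S.ξ p)
    rw [nablaForm_ricci hρ hS, S.inner_ξ, S.η_φ, S.η_ξ] at this
    linear_combination this
  · rintro rfl p x y z
    rw [nablaForm_ricci hρ hS, zero_mul]

omit hξ in
lemma isRicciSemiSymmetric_iff : IsRicciSemiSymmetric g ↔ b = 0 := by
  constructor
  · intro h
    obtain ⟨p⟩ := ‹Nonempty M›
    refine (S.eq_zero_of_smul_φ_add hE p (a := b) (b := 0) fun x y ↦ ?_).1
    -- Since `R(ξ, φx)ξ = φx`, the two terms are `-(a + b) g(φx, y)` and `a g(φx, y)`, with sum `-b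
    -- g(φx, y)`.
    have := h p (S.ξ p) (S.φ p x) y (S.ξ p)
    have h2 := inner_curvature_skew g p (S.ξ p) (S.φ p x) y (S.ξ p)
    rw [S.inner_ξ] at h2
    rw [hρ, hρ, S.inner_ξ, h2, curvature_ξ hS, S.η_φ, S.η_ξ, zero_smul, sub_zero, one_smul,
      S.η_φ, g.symm p y] at this
    linear_combination -this
  · rintro rfl p x y z w
    rw [hρ, hρ, inner_curvature_skew]
    ring

lemma isGloballyRicciPhiSymmetric_iff : S.IsGloballyRicciPhiSymmetric ↔ b = 0 := by
  constructor
  · rintro ⟨-, h⟩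
    obtain ⟨p⟩ := ‹Nonempty M›
    refine (S.eq_zero_of_smul_φ_add hE p (a := b) (b := 0) fun x y ↦ ?_).1
    have := congrArg (fun v ↦ g.inner p v y) (h p x (S.ξ p))
    simp only [nablaEnd_ricciOperator hρ hS, S.η_ξ, map_add, map_smul, S.φ_ξ, S.φ_φ (p := p)
      (x := S.φ p x), S.η_φ, map_zero, map_sub, _root_.add_apply, _root_.smul_apply,
      _root_.sub_apply, _root_.zero_apply, smul_eq_mul] at this
    linear_combination this
  · intro hb
    obtain ⟨h, -⟩ := isLocallyRicciPhiSymmetric_of_etaEinstein hρ hS hξ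
    refine ⟨h, fun p x y ↦ ?_⟩
    rw [nablaEnd_ricciOperator hρ hS, hb]
    simp

/-- The triple `(ξ, φx, ξ)` gives `(a + b) α(φx) = 0`, so `α ∘ φ = 0`. The triple `(φx, φy, ξ)` then
gives `b g(φx, y) = a α(ξ) g(φx, φy)`, and independence of `φ` and `φ²` forces `b = 0`. In both
cases the coefficient of `α + β` vanishes, so `β` is arbitrary and `β = α` covers the special weakly
symmetric case. -/
lemma eq_zero_of_almostPseudoRicciEquation {α β : Π p : M, TangentSpace I p →L[ℝ] ℝ}
    (h : AlmostPseudoRicciEquation g α β) : b = 0 := by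
  obtain ⟨p⟩ := ‹Nonempty M›
  have h : ∀ x y z : TangentSpace I p,
      b * (g.inner p (S.φ p x) y * S.η p z + S.η p y * g.inner p (S.φ p x) z)
      = (α p x + β p x) * (a * g.inner p y z + b * (S.η p y * S.η p z))
        + α p y * (a * g.inner p x z + b * (S.η p x * S.η p z))
        + α p z * (a * g.inner p x y + b * (S.η p x * S.η p y)) := by
    intro x y z
    rw [← nablaForm_ricci hρ hS, h, hρ, hρ, hρ]
  have hφ0 : ∀ x, α p (S.φ p x) = 0 := by
    intro x
    have h1 := h (S.ξ p) (S.φ p x) (S.ξ p)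
    simp only [S.φ_ξ, S.inner_ξ, S.inner_ξ_left, S.η_φ, S.η_ξ, map_zero,
      _root_.zero_apply] at h1
    refine (mul_eq_zero.1 (show (a + b) * α p (S.φ p x) = 0 by linear_combination -h1)).resolve_left
      hξ
  refine (S.eq_zero_of_smul_φ_add hE p (a := b) (b := -(a * α p (S.ξ p))) fun x y ↦ ?_).1
  have h2 := h (S.φ p x) (S.φ p y) (S.ξ p)
  have h3 := S.inner_φ_φ p (S.φ p x) y
  simp only [hφ0, S.inner_ξ, S.η_φ, S.η_ξ] at h2 h3
  linear_combination h2 - b * h3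

lemma isAlmostPseudoRicciSymmetric_iff : IsAlmostPseudoRicciSymmetric g ↔ b = 0 := by
  constructor
  · rintro ⟨-, α, β, -, -, h⟩
    exact eq_zero_of_almostPseudoRicciEquation hρ hS hξ hE h
  · intro hb
    have h0 : IsSmoothOneForm I (fun p : M ↦ (0 : TangentSpace I p →L[ℝ] ℝ)) :=
      contMDiff_zeroSection ℝ _
    refine ⟨ricciNonvanishing_of_etaEinstein hρ hξ, 0, 0, h0, h0, fun p x y z ↦ ?_⟩
    rw [nablaForm_ricci hρ hS, hb]
    simp

lemma isSpecialWeaklyRicciSymmetric_iff : IsSpecialWeaklyRicciSymmetric g ↔ b = 0 := by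
  constructor
  · rintro ⟨-, α, -, h⟩
    refine eq_zero_of_almostPseudoRicciEquation (α := α) (β := α) hρ hS hξ hE fun p x y z ↦ ?_
    rw [h, two_mul]
  · intro hb
    have h0 : IsSmoothOneForm I (fun p : M ↦ (0 : TangentSpace I p →L[ℝ] ℝ)) :=
      contMDiff_zeroSection ℝ _
    refine ⟨ricciNonvanishing_of_etaEinstein hρ hξ, 0, h0, fun p x y z ↦ ?_⟩
    rw [nablaForm_ricci hρ hS, hb]
    simp

lemma hasCyclicParallelRicci_iff : HasCyclicParallelRicci g ↔ b = 0 := by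
  constructor
  · rintro ⟨-, h⟩
    obtain ⟨p⟩ := ‹Nonempty M›
    refine (S.eq_zero_of_smul_φ_add hE p (a := b) (b := 0) fun x y ↦ ?_).1
    -- The cyclic sum here is `2b g(φx, y)`: the term differentiated along `ξ` vanishes and the
    -- other two agree by symmetry of `φ`.
    have := h p x y (S.ξ p)
    simp only [nablaForm_ricci hρ hS, S.inner_ξ, S.η_φ, S.η_ξ, S.φ_ξ, map_zero,
      _root_.zero_apply, ← S.inner_φ_right p y x, g.symm p y (S.φ p x)] at this
    linear_combination this / 2
  · intro hb
    refine ⟨ricciNonvanishing_of_etaEinstein hρ hξ, fun p x y z ↦ ?_⟩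
    simp [nablaForm_ricci hρ hS, hb]

lemma hasCodazziRicci_iff : HasCodazziRicci g ↔ b = 0 := by
  constructor
  · rintro ⟨-, h⟩
    obtain ⟨p⟩ := ‹Nonempty M›
    refine (S.eq_zero_of_smul_φ_add hE p (a := b) (b := 0) fun x y ↦ ?_).1
    have := h p x (S.ξ p) y
    simp only [nablaForm_ricci hρ hS, S.inner_ξ, S.η_φ, S.η_ξ, S.φ_ξ, map_zero,
      _root_.zero_apply] at this
    linear_combination this
  · intro hb
    refine ⟨ricciNonvanishing_of_etaEinstein hρ hξ, fun p x y z ↦ ?_⟩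
    simp [nablaForm_ricci hρ hS, hb]

end PiStructure

end PiManifold

end

/-! ### The soliton case: `a = -λ`, `b = λ - 2n`, `a + b = -2n` -/

theorem mainTheorem3 {E : Type*} [NormedAddCommGroup E] [NormedSpace ℝ E]
    [FiniteDimensional ℝ E] {H : Type*} [TopologicalSpace H] {I : ModelWithCorners ℝ E H}
    {M : Type*} [TopologicalSpace M] [T2Space M] [SecondCountableTopology M] [Nonempty M]
    [ChartedSpace H M] [IsManifold I ∞ M] [BoundarylessManifold I M]
    (n : ℕ) (hn : 1 ≤ n) (hdim : Module.finrank ℝ E = 2 * n + 1)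
    (g : ContMDiffRiemannianMetric I ∞ E (fun p : M ↦ TangentSpace I p))
    (S : PiManifold.PiStructure g) (hS : S.IsParaSasakiLike)
    (k : M → ℝ) (hk : ContMDiff I 𝓘(ℝ, ℝ) ∞ k) (lam mu nu : ℝ)
    (hsol : S.IsParaRicciLikeSoliton (fun p ↦ k p • S.ξ p) lam mu nu) :
    S.IsLocallyRicciPhiSymmetric ∧
    (PiManifold.IsLocallyRicciSymmetric g ↔ PiManifold.IsEinstein g) ∧
    (PiManifold.IsRicciSemiSymmetric g ↔ PiManifold.IsEinstein g) ∧
    (S.IsGloballyRicciPhiSymmetric ↔ PiManifold.IsEinstein g) ∧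
    (PiManifold.IsAlmostPseudoRicciSymmetric g ↔ PiManifold.IsEinstein g) ∧
    (PiManifold.IsProperAlmostPseudoRicciSymmetric g ↔ PiManifold.IsEinstein g) ∧
    (PiManifold.IsSpecialWeaklyRicciSymmetric g ↔ PiManifold.IsEinstein g) ∧
    (PiManifold.HasCyclicParallelRicci g ↔ PiManifold.IsEinstein g) ∧
    (PiManifold.HasCodazziRicci g ↔ PiManifold.IsEinstein g) := by
  have hE : 1 < Module.finrank ℝ E := by omega
  have hn0 : (0 : ℝ) < n := by exact_mod_cast hn
  have hρ := PiManifold.PiStructure.ricci_of_soliton hS hk hsol hE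
  have hrank : (Module.finrank ℝ E : ℝ) - 1 = 2 * n := by
    rw [hdim]
    push_cast
    ring
  rw [hrank] at hρ
  have hξ : -lam + (lam - 2 * n) ≠ 0 := by
    intro h
    linarith
  have hlam : lam = 0 :=
    (PiManifold.PiStructure.soliton_constants hS hk hsol hE (Classical.arbitrary M)).2
  have hEin := PiManifold.PiStructure.isEinstein_iff hρ hE
  have hAPRS := PiManifold.PiStructure.isAlmostPseudoRicciSymmetric_iff hρ hS hξ hE
  refine ⟨PiManifold.PiStructure.isLocallyRicciPhiSymmetric_of_etaEinstein hρ hS hξ,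
    (PiManifold.PiStructure.isLocallyRicciSymmetric_iff hρ hS hE).trans hEin.symm,
    (PiManifold.PiStructure.isRicciSemiSymmetric_iff hρ hS hE).trans hEin.symm,
    (PiManifold.PiStructure.isGloballyRicciPhiSymmetric_iff hρ hS hξ hE).trans hEin.symm,
    hAPRS.trans hEin.symm, ⟨?_, ?_⟩,
    (PiManifold.PiStructure.isSpecialWeaklyRicciSymmetric_iff hρ hS hξ hE).trans hEin.symm,
    (PiManifold.PiStructure.hasCyclicParallelRicci_iff hρ hS hξ hE).trans hEin.symm,
    (PiManifold.PiStructure.hasCodazziRicci_iff hρ hS hξ hE).trans hEin.symm⟩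
  · rintro ⟨h0, α, β, hα, hβ, -, -, h⟩
    exact hEin.2 (hAPRS.1 ⟨h0, α, β, hα, hβ, h⟩)
  -- No forms `α`, `β` are constructed: Einstein would mean `λ = 2n`, contradicting `λ = 0` and `n ≥
  -- 1`.
  · intro h
    have := hEin.1 h
    linarith
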